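/- Let $p\in[0,1]$ and let $\xi$ be a random subset of $\{1,2,\dots\}\times\{1,2,\dots\}$ which contains each point independently of the others with probability $p$. For integers $n,m\ge 0$ let $$L^{(1)}_{(n,m)}=\max\{L:\ \exists\,(i_1,j_1),\dots,(i_L,j_L)\in\xi\cap([1,n]\times[1,m]),\ i_1<\dots<i_L,\ j_1<\dots<j_L\},$$ $$L^{(2)}_{(n,m)}=\max\{L:\ \exists\,(i_1,j_1),\dots,(i_L,j_L)\in\xi\cap([1,n]\times[1,m]),\ i_1<\dots<i_L,\ j_1\le\dots\le j_L\}$$ (the empty sequence, $L=0$, is allowed). Then, for all real $a,b>0$, almost surely as the integer $n$ tends to infinity, $$\frac{L^{(1)}_{(\lfloor an\rfloor,\lfloor bn\rfloor)}}{n}\longrightarrow\begin{cases}\dfrac{\sqrt p\,\bigl(2\sqrt{ab}-(a+b)\sqrt p\bigr)}{1-p}&\text{if }p<\min\{a/b,\,b/a\},\\[2mm]\min\{a,b\}&\text{otherwise,}\end{cases}$$ $$\frac{L^{(2)}_{(\lfloor an\rfloor,\lfloor bn\rfloor)}}{n}\longrightarrow\begin{cases}2\sqrt{abp(1-p)}+(a-b)p&\text{if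 }p<a/(a+b),\\ a&\text{otherwise.}\end{cases}$$ -/

import Mathlib

open MeasureTheory ProbabilityTheory Filter Topology

/-- `ξ` is the random set of points of the quadrant `{1, 2, …} × {1, 2, …}` obtained by keeping each
point independently of the others with probability `p`. -/
structure IsBernoulliPointSet {Ω : Type*} [MeasurableSpace Ω] (μ : Measure Ω) (p : ℝ)
    (ξ : Ω → Set (ℕ+ × ℕ+)) : Prop where
  measurableSet_mem : ∀ q, MeasurableSet {ω | q ∈ ξ ω}
  measure_mem : ∀ q, μ {ω | q ∈ ξ ω} = ENNReal.ofReal p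
  indep : iIndepSet (fun q => {ω | q ∈ ξ ω}) μ

/-- The lengths of the sequences `(i₁, j₁), …, (i_L, j_L)` of points of `S` in the rectangle
`[1, n] × [1, m]` such that `i₁ < ⋯ < i_L` and `j₁ < ⋯ < j_L`. -/
def strictChainLengths (S : Set (ℕ+ × ℕ+)) (n m : ℕ) : Set ℕ :=
  {L | ∃ c : Fin L → ℕ+ × ℕ+,
    (∀ k, c k ∈ S ∧ ((c k).1 : ℕ) ≤ n ∧ ((c k).2 : ℕ) ≤ m) ∧
    StrictMono (fun k => (c k).1) ∧ StrictMono (fun k => (c k).2)}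

/-- The lengths of the sequences `(i₁, j₁), …, (i_L, j_L)` of points of `S` in the rectangle
`[1, n] × [1, m]` such that `i₁ < ⋯ < i_L` and `j₁ ≤ ⋯ ≤ j_L`. -/
def weakChainLengths (S : Set (ℕ+ × ℕ+)) (n m : ℕ) : Set ℕ :=
  {L | ∃ c : Fin L → ℕ+ × ℕ+,
    (∀ k, c k ∈ S ∧ ((c k).1 : ℕ) ≤ n ∧ ((c k).2 : ℕ) ≤ m) ∧
    StrictMono (fun k => (c k).1) ∧ Monotone (fun k => (c k).2)}

/-- The length of the longest increasing sequence through points of `S` in `[1, n] × [1, m]`. -/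
noncomputable def longestStrict (S : Set (ℕ+ × ℕ+)) (n m : ℕ) : ℕ :=
  sSup (strictChainLengths S n m)

/-- The length of the longest sequence through points of `S` in `[1, n] × [1, m]` with increasing
first coordinates and non-decreasing second coordinates. -/
noncomputable def longestWeak (S : Set (ℕ+ × ℕ+)) (n m : ℕ) : ℕ :=
  sSup (weakChainLengths S n m)

theorem weakChainLengths_le {S : Set (ℕ+ × ℕ+)} {n m L : ℕ} (h : L ∈ weakChainLengths S n m) :
    L ≤ n := by
  obtain ⟨c, hc, h1, -⟩ := h
  have hinj : Function.Injective (fun k => ((c k).1 : ℕ)) := fun x y hxy =>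
    h1.injective (PNat.coe_injective hxy)
  have := Finset.card_le_card_of_injOn (s := Finset.univ) (t := Finset.Icc 1 n)
    (fun k => ((c k).1 : ℕ)) (fun k _ => Finset.mem_coe.2 (Finset.mem_Icc.2 ⟨(c k).1.pos, (hc k).2.1⟩)) hinj.injOn
  simpa using this

theorem strictChainLengths_subset (S : Set (ℕ+ × ℕ+)) (n m : ℕ) :
    strictChainLengths S n m ⊆ weakChainLengths S n m := by
  rintro L ⟨c, hc, h1, h2⟩
  exact ⟨c, hc, h1, h2.monotone⟩

theorem zero_mem_strictChainLengths (S : Set (ℕ+ × ℕ+)) (n m : ℕ) :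
    0 ∈ strictChainLengths S n m :=
  ⟨Fin.elim0, fun k => k.elim0, fun k => k.elim0, fun k => k.elim0⟩

/-- The supremum defining `longestStrict` is a maximum. -/
theorem isGreatest_longestStrict (S : Set (ℕ+ × ℕ+)) (n m : ℕ) :
    IsGreatest (strictChainLengths S n m) (longestStrict S n m) := by
  have hb : BddAbove (strictChainLengths S n m) :=
    ⟨n, fun _ h => weakChainLengths_le (strictChainLengths_subset S n m h)⟩
  exact ⟨Nat.sSup_mem ⟨0, zero_mem_strictChainLengths S n m⟩ hb, fun _ h => le_csSup hb h⟩

/-- The supremum defining `longestWeak` is a maximum. -/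
theorem isGreatest_longestWeak (S : Set (ℕ+ × ℕ+)) (n m : ℕ) :
    IsGreatest (weakChainLengths S n m) (longestWeak S n m) := by
  have hb : BddAbove (weakChainLengths S n m) := ⟨n, fun _ h => weakChainLengths_le h⟩
  exact ⟨Nat.sSup_mem ⟨0, strictChainLengths_subset S n m (zero_mem_strictChainLengths S n m)⟩ hb,
    fun _ h => le_csSup hb h⟩

/-! Longest chains are last passage values `G(i, j)` on a lattice, and their growth is computed by
adding sources on the boundary. Put increments `x` along the bottom and `y` along the left side. A
cell turns its bottom and left increments and the state of its point into top and right increments.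
For suitable product laws (Bernoulli/Bernoulli in the strict case, Bernoulli/geometric in the weak
one) this map preserves the law of the pair of increments (`cellStationary_strict`,
`cellStationary_weak`). The vertical increments right of any column are then again independent with
the law of `y`, so `G(an, bn)` is a sum of two i.i.d. sums. These two sums are dependent, but each
obeys a strong law, so with means `α`, `β` almost surely `G(an, bn) / n → aα + bβ`.

Upper bound: removing the sources only lowers the value, so every stationary pair `(α, β)` gives the
bound `aα + bβ`. The stationary pairs form a branch of a hyperbola, on which this rate has a
minimizer.

Lower bound: an optimal path with sources leaves the boundary at some `k` (`exists_exit`). Leaving a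
second stationary boundary, of density `α' > α`, at the same `k` is possible, so `(α' - α) k` is at
most, up to `o(n)`, `n` times the difference of the two rates. At the minimizer that difference is
quadratic in the displacement along the curve, which forces `k ≤ εn`: the sources contribute
negligibly, and the value without sources has the same rate (`HasStationaryBoundary.eventually_ge`,
`rateAtLeast_of_curve`).

The minimizer is admissible exactly in the first regime of each limit. At the critical direction the
rate equals the trivial upper bound, and monotonicity in the direction carries it to the degenerate
regime. The densities `p = 0` and `p = 1` are treated apart. -/

open scoped ENNReal

/-! ### The local rule and last passage values with boundary -/

/-- The increment of the last passage value across the diagonal of a cell, given the increments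
`x` along its bottom side and `y` along its left side. -/
def cellIncrement (strict : Bool) (x y : ℕ) (e : Bool) : ℕ :=
  max (max x y) ((if strict then 0 else y) + e.toNat)

theorem left_le_cellIncrement (strict : Bool) (x y : ℕ) (e : Bool) :
    x ≤ cellIncrement strict x y e := by
  unfold cellIncrement; omega

theorem right_le_cellIncrement (strict : Bool) (x y : ℕ) (e : Bool) :
    y ≤ cellIncrement strict x y e := by
  unfold cellIncrement; omega

/-- The increment along the bottom side of the cell at height `j` of a column. -/
def columnBottom (strict : Bool) (x : ℕ) (y : ℕ → ℕ) (e : ℕ → Bool) : ℕ → ℕ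
  | 0 => x
  | j + 1 => cellIncrement strict (columnBottom strict x y e j) (y j) (e j) - y j

/-- The increment along the right side of the cell at height `j` of a column. -/
def columnRight (strict : Bool) (x : ℕ) (y : ℕ → ℕ) (e : ℕ → Bool) (j : ℕ) : ℕ :=
  cellIncrement strict (columnBottom strict x y e j) (y j) (e j) - columnBottom strict x y e j

/-- The vertical increments to the right of the first `i` columns. -/
def verticalIncrement (strict : Bool) (e : ℕ → ℕ → Bool) (x y : ℕ → ℕ) : ℕ → ℕ → ℕ
  | 0 => y
  | i + 1 => columnRight strict (x i) (verticalIncrement strict e x y i) (e i)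

/-- The last passage value with bottom boundary increments `x` and left boundary increments `y`. -/
def lastPassage (strict : Bool) (e : ℕ → ℕ → Bool) (x y : ℕ → ℕ) (i j : ℕ) : ℕ :=
  ∑ k ∈ Finset.range i, x k + ∑ l ∈ Finset.range j, verticalIncrement strict e x y i l

section LastPassage

variable (strict : Bool) (e : ℕ → ℕ → Bool) (x y : ℕ → ℕ)

theorem lastPassage_zero_left (j : ℕ) :
    lastPassage strict e x y 0 j = ∑ l ∈ Finset.range j, y l := by
  simp [lastPassage, verticalIncrement]

theorem lastPassage_zero_right (i : ℕ) :
    lastPassage strict e x y i 0 = ∑ k ∈ Finset.range i, x k := by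
  simp [lastPassage]

theorem lastPassage_succ_right (i j : ℕ) :
    lastPassage strict e x y i (j + 1) =
      lastPassage strict e x y i j + verticalIncrement strict e x y i j := by
  simp [lastPassage, Finset.sum_range_succ, add_assoc]

/-- Going right then up, or up then right, around a cell gives the same diagonal increment, so the
value defined along one path is consistent along all of them. -/
theorem lastPassage_succ_left (i j : ℕ) :
    lastPassage strict e x y (i + 1) j = lastPassage strict e x y i j +
      columnBottom strict (x i) (verticalIncrement strict e x y i) (e i) j := by
  induction j with
  | zero => simp [lastPassage_zero_right, Finset.sum_range_succ, columnBottom]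
  | succ j ih =>
    rw [lastPassage_succ_right, ih, lastPassage_succ_right]
    simp only [verticalIncrement, columnBottom, columnRight]
    have h1 := left_le_cellIncrement strict
      (columnBottom strict (x i) (verticalIncrement strict e x y i) (e i) j)
      (verticalIncrement strict e x y i j) (e i j)
    have h2 := right_le_cellIncrement strict
      (columnBottom strict (x i) (verticalIncrement strict e x y i) (e i) j)
      (verticalIncrement strict e x y i j) (e i j)
    omega

/-- This recursion is what the later path arguments use. A point extends a path ending at the lower
left corner of its cell in the strict case, and at the upper left corner in the weak case, where the
row may be shared. -/
theorem lastPassage_succ_succ (i j : ℕ) :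
    lastPassage strict e x y (i + 1) (j + 1) =
      max (max (lastPassage strict e x y (i + 1) j) (lastPassage strict e x y i (j + 1)))
        ((if strict then lastPassage strict e x y i j else lastPassage strict e x y i (j + 1)) +
          (e i j).toNat) := by
  rw [lastPassage_succ_left strict e x y i (j + 1), lastPassage_succ_left strict e x y i j,
    lastPassage_succ_right]
  simp only [columnBottom]
  have h2 := right_le_cellIncrement strict
    (columnBottom strict (x i) (verticalIncrement strict e x y i) (e i) j)
    (verticalIncrement strict e x y i j) (e i j)
  rw [add_assoc, Nat.add_sub_cancel' h2]
  unfold cellIncrement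
  cases strict <;> simp <;> omega

theorem lastPassage_mono_left (j : ℕ) : Monotone fun i => lastPassage strict e x y i j :=
  monotone_nat_of_le_succ fun i => by rw [lastPassage_succ_left]; omega

theorem lastPassage_mono_right (i : ℕ) : Monotone (lastPassage strict e x y i) :=
  monotone_nat_of_le_succ fun j => by rw [lastPassage_succ_right]; omega

theorem lastPassage_mono {i i' j j' : ℕ} (hi : i ≤ i') (hj : j ≤ j') :
    lastPassage strict e x y i j ≤ lastPassage strict e x y i' j' :=
  (lastPassage_mono_left strict e x y j hi).trans (lastPassage_mono_right strict e x y i' hj)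

/-- Leaving the bottom boundary at `k` gives a lower bound for the last passage value. -/
theorem sum_add_lastPassage_le_bottom (k i j : ℕ) :
    ∑ r ∈ Finset.range k, x r + lastPassage strict (fun i => e (k + i)) 0 0 i j ≤
      lastPassage strict e x y (k + i) j := by
  induction i generalizing j with
  | zero =>
    rw [lastPassage_zero_left, ← lastPassage_zero_right strict e x y]
    simpa using lastPassage_mono_right strict e x y k (Nat.zero_le j)
  | succ i ih =>
    induction j with
    | zero =>
      rw [lastPassage_zero_right, ← lastPassage_zero_right strict e x y]
      simpa using lastPassage_mono_left strict e x y 0 (Nat.le_add_right k (i + 1))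
    | succ j ihj =>
      rw [← add_assoc k i 1] at ihj ⊢
      rw [lastPassage_succ_succ, lastPassage_succ_succ]
      have h1 := ih j
      have h2 := ih (j + 1)
      cases strict <;> simp <;> omega

/-- Leaving the left boundary at `k` gives a lower bound for the last passage value. -/
theorem sum_add_lastPassage_le_left (k i j : ℕ) :
    ∑ r ∈ Finset.range k, y r + lastPassage strict (fun i j => e i (k + j)) 0 0 i j ≤
      lastPassage strict e x y i (k + j) := by
  induction i generalizing j with
  | zero =>
    simp only [lastPassage_zero_left]
    simpa using Finset.sum_le_sum_of_subset (f := y)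
      (Finset.range_mono (Nat.le_add_right k j))
  | succ i ih =>
    induction j with
    | zero =>
      rw [lastPassage_zero_right, ← lastPassage_zero_left strict e x y]
      simpa using lastPassage_mono_left strict e x y k (Nat.zero_le (i + 1))
    | succ j ihj =>
      have h1 := ih j
      have h2 := ih (j + 1)
      rw [← add_assoc k j 1] at h2 ⊢
      rw [lastPassage_succ_succ, lastPassage_succ_succ]
      cases strict <;> simp <;> omega

theorem lastPassage_zero_boundary_le (i j : ℕ) :
    lastPassage strict e 0 0 i j ≤ lastPassage strict e x y i j := by
  simpa using sum_add_lastPassage_le_bottom strict e x y 0 i j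

/-- An optimal path leaves the bottom boundary or the left boundary somewhere. -/
theorem exists_exit (i j : ℕ) :
    (∃ k i', i = k + i' ∧ lastPassage strict e x y i j ≤
      ∑ r ∈ Finset.range k, x r + lastPassage strict (fun i => e (k + i)) 0 0 i' j) ∨
    (∃ k j', j = k + (j' + 1) ∧ lastPassage strict e x y i j ≤
      ∑ r ∈ Finset.range (k + 1), y r +
        lastPassage strict (fun i j => e i (k + j)) 0 0 i (j' + 1)) := by
  induction i generalizing j with
  | zero =>
    cases j with
    | zero => exact Or.inl ⟨0, 0, by simp, by simp [lastPassage_zero_left]⟩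
    | succ j => exact Or.inr ⟨j, 0, by simp, by simp [lastPassage_zero_left]⟩
  | succ i ih =>
    induction j with
    | zero => exact Or.inl ⟨i + 1, 0, by simp, by simp [lastPassage_zero_right]⟩
    | succ j ihj =>
      have hstep : lastPassage strict e x y (i + 1) (j + 1) ≤ lastPassage strict e x y (i + 1) j ∨
          lastPassage strict e x y (i + 1) (j + 1) ≤
            lastPassage strict e x y i (if strict then j else j + 1) + (e i j).toNat ∨
          lastPassage strict e x y (i + 1) (j + 1) ≤ lastPassage strict e x y i (j + 1) := by
        rw [lastPassage_succ_succ]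
        cases strict <;> simp <;> omega
      rcases hstep with h | h | h
      · rcases ihj with ⟨k, i', h1, h2⟩ | ⟨k, j', h1, h2⟩
        · refine Or.inl ⟨k, i', h1, (h.trans h2).trans ?_⟩
          gcongr
          exact lastPassage_mono _ _ _ _ le_rfl (Nat.le_succ j)
        · refine Or.inr ⟨k, j' + 1, by omega, (h.trans h2).trans ?_⟩
          gcongr
          exact lastPassage_mono _ _ _ _ le_rfl (Nat.le_succ _)
      · rcases ih (if strict then j else j + 1) with ⟨k, i', h1, h2⟩ | ⟨k, j', h1, h2⟩
        · refine Or.inl ⟨k, i' + 1, by omega, h.trans ?_⟩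
          rw [lastPassage_succ_succ, ← h1]
          cases strict <;> simp at h2 ⊢ <;> omega
        -- The boundary sum of a left exit includes row `k`, where the inner path starts again: a
        -- weak path may take the boundary increment of a row and then a point of that same row. In
        -- the strict case the overlap is merely a loss.
        · refine Or.inr ⟨k, if strict then j' + 1 else j', by cases strict <;> simp at h1 ⊢ <;> omega,
            h.trans ?_⟩
          rw [lastPassage_succ_succ]
          cases strict
          · simp only [Bool.false_eq_true, if_false] at h1 h2 ⊢
            have : j = k + j' := by omega
            subst this
            omega
          · simp only [if_true] at h1 h2 ⊢
            subst h1
            omega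
      · rcases ih (j + 1) with ⟨k, i', h1, h2⟩ | ⟨k, j', h1, h2⟩
        · refine Or.inl ⟨k, i' + 1, by omega, (h.trans h2).trans ?_⟩
          gcongr
          exact lastPassage_mono _ _ _ _ (Nat.le_succ _) le_rfl
        · refine Or.inr ⟨k, j', h1, (h.trans h2).trans ?_⟩
          gcongr
          exact lastPassage_mono _ _ _ _ (Nat.le_succ _) le_rfl

theorem lastPassage_bottom_shift_le (k i j : ℕ) :
    lastPassage strict (fun i => e (k + i)) 0 0 i j ≤ lastPassage strict e 0 0 (k + i) j := by
  simpa using sum_add_lastPassage_le_bottom strict e 0 0 k i j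

theorem lastPassage_left_shift_le (k i j : ℕ) :
    lastPassage strict (fun i j => e i (k + j)) 0 0 i j ≤ lastPassage strict e 0 0 i (k + j) := by
  simpa using sum_add_lastPassage_le_left strict e 0 0 k i j

end LastPassage

/-! ### Longest chains as last passage values -/

/-- The indicator of a set of points, with coordinates starting from `0`. -/
noncomputable def cells (S : Set (ℕ+ × ℕ+)) (i j : ℕ) : Bool :=
  open Classical in decide ((i.succPNat, j.succPNat) ∈ S)

theorem cells_eq_true {S : Set (ℕ+ × ℕ+)} {i j : ℕ} :
    cells S i j = true ↔ (i.succPNat, j.succPNat) ∈ S := by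
  simp [cells]

/-- The lengths of chains in `[1, n] × [1, m]`, strict or weak in the second coordinate. -/
def chainLengths (strict : Bool) (S : Set (ℕ+ × ℕ+)) (n m : ℕ) : Set ℕ :=
  if strict then strictChainLengths S n m else weakChainLengths S n m

/-- The summand `strict.toNat` puts both order conditions into one inequality, so that both kinds of
chain share one proof. -/
theorem mem_chainLengths {strict : Bool} {S : Set (ℕ+ × ℕ+)} {n m L : ℕ} :
    L ∈ chainLengths strict S n m ↔ ∃ c : Fin L → ℕ+ × ℕ+,
      (∀ k, c k ∈ S ∧ ((c k).1 : ℕ) ≤ n ∧ ((c k).2 : ℕ) ≤ m) ∧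
      (∀ k l, k < l → (c k).1 < (c l).1) ∧
      (∀ k l, k < l → ((c k).2 : ℕ) + strict.toNat ≤ (c l).2) := by
  cases strict
  · simp only [chainLengths, Bool.false_eq_true, if_false, weakChainLengths, Set.mem_ofPred_eq,
      monotone_iff_forall_lt, StrictMono]
    rfl
  · simp only [chainLengths, if_true, strictChainLengths, Set.mem_ofPred_eq, StrictMono]
    rfl

theorem chainLengths_mono (strict : Bool) (S : Set (ℕ+ × ℕ+)) {n n' m m' L : ℕ} (hn : n ≤ n')
    (hm : m ≤ m') (h : L ∈ chainLengths strict S n m) : L ∈ chainLengths strict S n' m' := by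
  obtain ⟨c, h1, h2⟩ := mem_chainLengths.1 h
  exact mem_chainLengths.2 ⟨c, fun k => ⟨(h1 k).1, (h1 k).2.1.trans hn, (h1 k).2.2.trans hm⟩, h2⟩

theorem succ_mem_chainLengths (strict : Bool) {S : Set (ℕ+ × ℕ+)} {i j L : ℕ}
    (hij : (i.succPNat, j.succPNat) ∈ S)
    (h : L ∈ chainLengths strict S i (if strict then j else j + 1)) :
    L + 1 ∈ chainLengths strict S (i + 1) (j + 1) := by
  obtain ⟨c, h1, h2, h3⟩ := mem_chainLengths.1 h
  refine mem_chainLengths.2 ⟨Fin.snoc (α := fun _ => ℕ+ × ℕ+) c (i.succPNat, j.succPNat), ?_, ?_, ?_⟩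
  · intro k
    induction k using Fin.lastCases with
    | last => simpa using hij
    | cast k =>
      obtain ⟨a1, a2, a3⟩ := h1 k
      simp only [Fin.snoc_castSucc]
      refine ⟨a1, by omega, ?_⟩
      cases strict <;> simp at a3 <;> omega
  · intro k l hkl
    induction l using Fin.lastCases with
    | last =>
      induction k using Fin.lastCases with
      | last => exact absurd hkl (lt_irrefl _)
      | cast k =>
        simp only [Fin.snoc_castSucc, Fin.snoc_last, ← PNat.coe_lt_coe, Nat.succPNat_coe]
        have := (h1 k).2.1
        omega
    | cast l =>
      induction k using Fin.lastCases with
      | last => exact absurd hkl (not_lt.2 (Fin.le_last _))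
      | cast k =>
        simp only [Fin.snoc_castSucc]
        exact h2 k l (by simpa using hkl)
  · intro k l hkl
    induction l using Fin.lastCases with
    | last =>
      induction k using Fin.lastCases with
      | last => exact absurd hkl (lt_irrefl _)
      | cast k =>
        simp only [Fin.snoc_castSucc, Fin.snoc_last, Nat.succPNat_coe]
        have := (h1 k).2.2
        cases strict <;> simp at this ⊢ <;> omega
    | cast l =>
      induction k using Fin.lastCases with
      | last => exact absurd hkl (not_lt.2 (Fin.le_last _))
      | cast k =>
        simp only [Fin.snoc_castSucc]
        exact h3 k l (by simpa using hkl)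

theorem lastPassage_mem_chainLengths (strict : Bool) (S : Set (ℕ+ × ℕ+)) (n m : ℕ) :
    lastPassage strict (cells S) 0 0 n m ∈ chainLengths strict S n m := by
  have h0 : ∀ n m, 0 ∈ chainLengths strict S n m := fun n m =>
    mem_chainLengths.2 ⟨Fin.elim0, fun k => k.elim0, fun k => k.elim0, fun k => k.elim0⟩
  induction n generalizing m with
  | zero => simpa [lastPassage_zero_left] using h0 0 m
  | succ n ih =>
    induction m with
    | zero => simpa [lastPassage_zero_right] using h0 (n + 1) 0
    | succ m ihm =>
      rw [lastPassage_succ_succ]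
      rcases max_cases (max (lastPassage strict (cells S) 0 0 (n + 1) m)
        (lastPassage strict (cells S) 0 0 n (m + 1)))
        ((if strict then lastPassage strict (cells S) 0 0 n m else
          lastPassage strict (cells S) 0 0 n (m + 1)) + (cells S n m).toNat) with ⟨h, -⟩ | ⟨h, h'⟩
      · rw [h]
        rcases max_choice (lastPassage strict (cells S) 0 0 (n + 1) m)
          (lastPassage strict (cells S) 0 0 n (m + 1)) with h | h <;> rw [h]
        · exact chainLengths_mono strict S le_rfl (Nat.le_succ m) ihm
        · exact chainLengths_mono strict S (Nat.le_succ n) le_rfl (ih _)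
      · rw [h]
        cases hc : cells S n m
        · rw [hc] at h'
          have := lastPassage_mono strict (cells S) 0 0 (le_refl n) (Nat.le_succ m)
          cases strict <;> simp at h' this <;> omega
        · have := succ_mem_chainLengths strict (cells_eq_true.1 hc) (ih (if strict then m else m + 1))
          cases strict <;> simpa using this

theorem le_lastPassage_of_mem_chainLengths {strict : Bool} {S : Set (ℕ+ × ℕ+)} {n m L : ℕ}
    (h : L ∈ chainLengths strict S n m) : L ≤ lastPassage strict (cells S) 0 0 n m := by
  obtain ⟨c, h1, h2, h3⟩ := mem_chainLengths.1 h
  have key : ∀ (k : ℕ) (hk : k < L),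
      k + 1 ≤ lastPassage strict (cells S) 0 0 (c ⟨k, hk⟩).1 (c ⟨k, hk⟩).2 := by
    intro k hk
    obtain ⟨i, hi⟩ : ∃ i : ℕ, (c ⟨k, hk⟩).1 = i.succPNat := ⟨_, (PNat.succPNat_natPred _).symm⟩
    obtain ⟨j, hj⟩ : ∃ j : ℕ, (c ⟨k, hk⟩).2 = j.succPNat := ⟨_, (PNat.succPNat_natPred _).symm⟩
    have he : cells S i j = true := by
      rw [cells_eq_true, ← hi, ← hj]
      exact (h1 _).1
    -- The induction runs on the corner from which the point of index `k` extends a path: the `k`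
    -- earlier points of the chain already count there.
    suffices k ≤ lastPassage strict (cells S) 0 0 i (if strict then j else j + 1) by
      rw [hi, hj, Nat.succPNat_coe, Nat.succPNat_coe, Nat.succ_eq_add_one, Nat.succ_eq_add_one,
        lastPassage_succ_succ, he]
      cases strict <;> simp at this ⊢ <;> omega
    induction k generalizing i j with
    | zero => exact Nat.zero_le _
    | succ k ih =>
      have hlt : (⟨k, by omega⟩ : Fin L) < ⟨k + 1, hk⟩ := by simp
      have a1 := h2 _ _ hlt
      have a2 := h3 _ _ hlt
      obtain ⟨i', hi'⟩ : ∃ i : ℕ, (c ⟨k, by omega⟩).1 = i.succPNat :=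
        ⟨_, (PNat.succPNat_natPred _).symm⟩
      obtain ⟨j', hj'⟩ : ∃ j : ℕ, (c ⟨k, by omega⟩).2 = j.succPNat :=
        ⟨_, (PNat.succPNat_natPred _).symm⟩
      have he' : cells S i' j' = true := by
        rw [cells_eq_true, ← hi', ← hj']
        exact (h1 _).1
      have a3 := ih (by omega) i' hi' j' hj' he'
      rw [hi, hi', ← PNat.coe_lt_coe, Nat.succPNat_coe, Nat.succPNat_coe] at a1
      rw [hj, hj', Nat.succPNat_coe, Nat.succPNat_coe] at a2
      have a4 : k + 1 ≤ lastPassage strict (cells S) 0 0 (i' + 1) (j' + 1) := by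
        rw [lastPassage_succ_succ, he']
        cases strict <;> simp at a3 ⊢ <;> omega
      refine a4.trans (lastPassage_mono _ _ _ _ (by omega) ?_)
      cases strict <;> simp at a2 ⊢ <;> omega
  cases L with
  | zero => exact Nat.zero_le _
  | succ L =>
    exact (key L (by omega)).trans (lastPassage_mono _ _ _ _ (h1 _).2.1 (h1 _).2.2)

theorem isGreatest_lastPassage (strict : Bool) (S : Set (ℕ+ × ℕ+)) (n m : ℕ) :
    IsGreatest (chainLengths strict S n m) (lastPassage strict (cells S) 0 0 n m) :=
  ⟨lastPassage_mem_chainLengths strict S n m, fun _ h => le_lastPassage_of_mem_chainLengths h⟩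

theorem longestStrict_eq (S : Set (ℕ+ × ℕ+)) (n m : ℕ) :
    longestStrict S n m = lastPassage true (cells S) 0 0 n m :=
  (isGreatest_longestStrict S n m).unique (isGreatest_lastPassage true S n m)

theorem longestWeak_eq (S : Set (ℕ+ × ℕ+)) (n m : ℕ) :
    longestWeak S n m = lastPassage false (cells S) 0 0 n m :=
  (isGreatest_longestWeak S n m).unique (isGreatest_lastPassage false S n m)

/-! ### Weighted sums over independent coordinates -/

/-- The sum of `f` against the weight `w`. -/
noncomputable def wsum {A : Type*} (w : A → ℝ≥0∞) (f : A → ℝ≥0∞) : ℝ≥0∞ := ∑' a, w a * f a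

/-- The product weight on vectors. -/
noncomputable def vecWeight {A : Type*} (w : A → ℝ≥0∞) (m : ℕ) (v : Fin m → A) : ℝ≥0∞ :=
  ∏ j, w (v j)

/-- Prepend a term to a sequence. -/
def seqCons {A : Type*} (a : A) (s : ℕ → A) : ℕ → A
  | 0 => a
  | j + 1 => s j

/-- Extend a vector to a sequence by a default value. -/
def vecExtend {A : Type*} [Inhabited A] {m : ℕ} (v : Fin m → A) (j : ℕ) : A :=
  if h : j < m then v ⟨j, h⟩ else default

section Wsum

variable {A B : Type*}

theorem vecExtend_cons [Inhabited A] {m : ℕ} (a : A) (v : Fin m → A) :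
    vecExtend (Fin.cons a v : Fin (m + 1) → A) = seqCons a (vecExtend v) := by
  funext j
  cases j with
  | zero => simp [vecExtend, seqCons]
  | succ j =>
    by_cases h : j < m
    · rw [vecExtend, dif_pos (by omega : j + 1 < m + 1), seqCons, vecExtend, dif_pos h]
      exact Fin.cons_succ (α := fun _ => A) a v ⟨j, h⟩
    · simp [vecExtend, seqCons, h]

theorem vecExtend_apply_fin [Inhabited A] {m : ℕ} (v : Fin m → A) (j : Fin m) :
    vecExtend v j = v j := by
  simp [vecExtend]

theorem wsum_const {w : A → ℝ≥0∞} (hw : ∑' a, w a = 1) (c : ℝ≥0∞) : wsum w (fun _ => c) = c := by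
  rw [wsum, ENNReal.tsum_mul_right, hw, one_mul]

theorem wsum_mono (w : A → ℝ≥0∞) {f g : A → ℝ≥0∞} (h : ∀ a, f a ≤ g a) : wsum w f ≤ wsum w g :=
  ENNReal.tsum_le_tsum fun a => mul_le_mul_right (h a) _

theorem wsum_mul_left (w : A → ℝ≥0∞) (c : ℝ≥0∞) (f : A → ℝ≥0∞) :
    wsum w (fun a => c * f a) = c * wsum w f := by
  simp only [wsum, ← ENNReal.tsum_mul_left]
  exact tsum_congr fun a => by ring

theorem wsum_comm (w : A → ℝ≥0∞) (w' : B → ℝ≥0∞) (f : A → B → ℝ≥0∞) :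
    wsum w (fun a => wsum w' (f a)) = wsum w' (fun b => wsum w fun a => f a b) := by
  simp only [wsum, ← ENNReal.tsum_mul_left]
  rw [ENNReal.tsum_comm]
  exact tsum_congr fun a => tsum_congr fun b => by ring

theorem wsum_vecWeight_zero (w : A → ℝ≥0∞) (f : (Fin 0 → A) → ℝ≥0∞) :
    wsum (vecWeight w 0) f = f Fin.elim0 := by
  rw [wsum, tsum_eq_single Fin.elim0 fun v hv => absurd (Subsingleton.elim _ _) hv]
  simp [vecWeight]

theorem wsum_vecWeight_succ (w : A → ℝ≥0∞) (m : ℕ) (f : (Fin (m + 1) → A) → ℝ≥0∞) :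
    wsum (vecWeight w (m + 1)) f =
      wsum w fun a => wsum (vecWeight w m) fun v => f (Fin.cons a v) := by
  simp only [wsum]
  rw [← (Fin.consEquiv fun _ : Fin (m + 1) => A).tsum_eq, ENNReal.tsum_prod']
  refine tsum_congr fun a => ?_
  rw [← ENNReal.tsum_mul_left]
  refine tsum_congr fun v => ?_
  simp [Fin.consEquiv, vecWeight, Fin.prod_univ_succ, mul_assoc]

theorem wsum_vecWeight_prod (w : A → ℝ≥0∞) (φ : A → ℝ≥0∞) (m : ℕ) :
    wsum (vecWeight w m) (fun v => ∏ j, φ (v j)) = wsum w φ ^ m := by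
  induction m with
  | zero => simp [wsum_vecWeight_zero]
  | succ m ih =>
    rw [wsum_vecWeight_succ]
    simp only [Fin.prod_univ_succ, Fin.cons_zero, Fin.cons_succ, wsum_mul_left, ih]
    rw [pow_succ', mul_comm, ← wsum_mul_left]
    congr 1
    funext a
    ring

end Wsum

/-! ### Stationarity of the increments -/

/-- The weights `wx`, `wy` for horizontal and vertical increments are preserved by a cell whose
point is present according to `we`. -/
def CellStationary (strict : Bool) (wx wy : ℕ → ℝ≥0∞) (we : Bool → ℝ≥0∞) : Prop :=
  ∀ f : ℕ → ℕ → ℝ≥0∞,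
    (wsum wx fun x => wsum wy fun y => wsum we fun e =>
      f (cellIncrement strict x y e - y) (cellIncrement strict x y e - x)) =
    wsum wx fun x => wsum wy fun y => f x y

section Stationary

variable {strict : Bool}

theorem columnBottom_seqCons (x a : ℕ) (y : ℕ → ℕ) (c : Bool) (e : ℕ → Bool) (j : ℕ) :
    columnBottom strict x (seqCons a y) (seqCons c e) (j + 1) =
      columnBottom strict (cellIncrement strict x a c - a) y e j := by
  induction j with
  | zero => rfl
  | succ j ih => rw [columnBottom, ih]; rfl

theorem columnRight_seqCons_succ (x a : ℕ) (y : ℕ → ℕ) (c : Bool) (e : ℕ → Bool) (j : ℕ) :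
    columnRight strict x (seqCons a y) (seqCons c e) (j + 1) =
      columnRight strict (cellIncrement strict x a c - a) y e j := by
  rw [columnRight, columnBottom_seqCons]; rfl

theorem columnBottom_congr (x : ℕ) {y y' : ℕ → ℕ} {e e' : ℕ → Bool} {m : ℕ}
    (hy : ∀ j < m, y j = y' j) (he : ∀ j < m, e j = e' j) :
    columnBottom strict x y e m = columnBottom strict x y' e' m := by
  induction m with
  | zero => rfl
  | succ m ih =>
    simp only [columnBottom]
    rw [ih (fun j hj => hy j (by omega)) (fun j hj => he j (by omega)), hy m (by omega),
      he m (by omega)]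

theorem columnRight_congr (x : ℕ) {y y' : ℕ → ℕ} {e e' : ℕ → Bool} {m : ℕ}
    (hy : ∀ j < m, y j = y' j) (he : ∀ j < m, e j = e' j) {j : ℕ} (hj : j < m) :
    columnRight strict x y e j = columnRight strict x y' e' j := by
  rw [columnRight, columnRight, columnBottom_congr x (fun k hk => hy k (hk.trans hj))
    (fun k hk => he k (hk.trans hj)), hy j hj, he j hj]

/-- Only finitely many boundary values and cells matter, so infinite sequences can be replaced by
extensions of finite vectors and laws by countable sums. -/
theorem verticalIncrement_congr {e e' : ℕ → ℕ → Bool} {x x' y y' : ℕ → ℕ} {n m : ℕ}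
    (he : ∀ i < n, ∀ j < m, e i j = e' i j) (hx : ∀ i < n, x i = x' i)
    (hy : ∀ j < m, y j = y' j) {j : ℕ} (hj : j < m) :
    verticalIncrement strict e x y n j = verticalIncrement strict e' x' y' n j := by
  induction n generalizing j with
  | zero => exact hy j hj
  | succ n ih =>
    simp only [verticalIncrement]
    rw [hx n (by omega)]
    exact columnRight_congr _ (fun k hk => ih (fun i hi => he i (by omega))
      (fun i hi => hx i (by omega)) hk) (he n (by omega)) hj

theorem verticalIncrement_seqCons (a : ℕ) (c : ℕ → Bool) (e : ℕ → ℕ → Bool) (x y : ℕ → ℕ) (n : ℕ) :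
    verticalIncrement strict (seqCons c e) (seqCons a x) y (n + 1) =
      verticalIncrement strict e x (columnRight strict a y c) n := by
  induction n with
  | zero => rfl
  | succ n ih => rw [verticalIncrement, ih]; rfl

variable {wx wy : ℕ → ℝ≥0∞} {we : Bool → ℝ≥0∞}

/-- Sweep the column upwards: the lowest cell replaces its two incoming increments by two with the
same product law; the right one is final, and the top one is the bottom input of the remaining
column, independent of everything above. -/
theorem CellStationary.column (h : CellStationary strict wx wy we) (m : ℕ)
    (f : ℕ → (Fin m → ℕ) → ℝ≥0∞) :
    (wsum wx fun x => wsum (vecWeight wy m) fun v => wsum (vecWeight we m) fun u =>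
      f (columnBottom strict x (vecExtend v) (vecExtend u) m)
        (fun j => columnRight strict x (vecExtend v) (vecExtend u) j)) =
    wsum wx fun x => wsum (vecWeight wy m) fun v => f x v := by
  induction m with
  | zero =>
    simp only [wsum_vecWeight_zero, columnBottom]
    congr 1
    funext x
    congr 1
    exact Subsingleton.elim _ _
  | succ m ih =>
    have e1 : ∀ (x a : ℕ) (v : Fin m → ℕ) (c : Bool) (u : Fin m → Bool),
        (fun j : Fin (m + 1) => columnRight strict x (seqCons a (vecExtend v))
          (seqCons c (vecExtend u)) j) =
        Fin.cons (cellIncrement strict x a c - x) (fun j : Fin m => columnRight strict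
          (cellIncrement strict x a c - a) (vecExtend v) (vecExtend u) j) := by
      intro x a v c u
      funext j
      refine Fin.cases ?_ (fun j => ?_) j
      · rfl
      · simp only [Fin.val_succ, Fin.cons_succ]
        exact columnRight_seqCons_succ _ _ _ _ _ _
    simp only [wsum_vecWeight_succ, vecExtend_cons, columnBottom_seqCons, e1]
    -- The sum over the lowest point is moved next to the two increments of its cell, where
    -- stationarity applies.
    have e2 : ∀ (x a : ℕ), (wsum (vecWeight wy m) fun v => wsum we fun c =>
        wsum (vecWeight we m) fun u =>
          f (columnBottom strict (cellIncrement strict x a c - a) (vecExtend v) (vecExtend u) m)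
            (Fin.cons (cellIncrement strict x a c - x) (fun j : Fin m => columnRight strict
              (cellIncrement strict x a c - a) (vecExtend v) (vecExtend u) j))) =
        wsum we fun c => (fun x' a' => wsum (vecWeight wy m) fun v => wsum (vecWeight we m) fun u =>
          f (columnBottom strict x' (vecExtend v) (vecExtend u) m)
            (Fin.cons a' (fun j : Fin m => columnRight strict x' (vecExtend v) (vecExtend u) j)))
          (cellIncrement strict x a c - a) (cellIncrement strict x a c - x) := by
      intro x a
      rw [wsum_comm]
    simp only [e2]
    refine (h fun x' a' => wsum (vecWeight wy m) fun v => wsum (vecWeight we m) fun u =>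
      f (columnBottom strict x' (vecExtend v) (vecExtend u) m)
        (Fin.cons a' (fun j : Fin m => columnRight strict x' (vecExtend v) (vecExtend u) j))).trans ?_
    rw [wsum_comm, wsum_comm wx wy]
    congr 1
    funext a
    exact ih fun x v => f x (Fin.cons a v)

theorem CellStationary.verticalIncrement (h : CellStationary strict wx wy we)
    (hx : ∑' a, wx a = 1) (n m : ℕ) (f : (Fin m → ℕ) → ℝ≥0∞) :
    (wsum (vecWeight wx n) fun x => wsum (vecWeight wy m) fun v =>
      wsum (vecWeight (vecWeight we m) n) fun u =>
        f fun j => verticalIncrement strict (vecExtend fun i => vecExtend (u i)) (vecExtend x) (vecExtend v) n j) =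
    wsum (vecWeight wy m) f := by
  induction n with
  | zero =>
    simp only [wsum_vecWeight_zero, _root_.verticalIncrement, vecExtend_apply_fin]
  | succ n ih =>
    have e0 : ∀ (c : Fin m → Bool) (u : Fin n → Fin m → Bool),
        (vecExtend fun i => vecExtend ((Fin.cons c u : Fin (n + 1) → Fin m → Bool) i)) =
          seqCons (vecExtend c) (vecExtend fun i => vecExtend (u i)) := by
      intro c u
      rw [← vecExtend_cons]
      congr 1
      funext i
      refine Fin.cases ?_ (fun i => ?_) i <;> simp
    have e1 : ∀ (a : ℕ) (x : Fin n → ℕ) (v : Fin m → ℕ) (c : Fin m → Bool)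
        (u : Fin n → Fin m → Bool),
        (fun j : Fin m => _root_.verticalIncrement strict
          (seqCons (vecExtend c) (vecExtend fun i => vecExtend (u i)))
          (seqCons a (vecExtend x)) (vecExtend v) (n + 1) j) =
        (fun j : Fin m => _root_.verticalIncrement strict (vecExtend fun i => vecExtend (u i))
          (vecExtend x) (vecExtend fun j : Fin m => columnRight strict a (vecExtend v) (vecExtend c) j) n j) := by
      intro a x v c u
      funext j
      rw [verticalIncrement_seqCons]
      refine verticalIncrement_congr (fun _ _ _ _ => rfl) (fun _ _ => rfl) (fun k hk => ?_) j.2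
      simp [vecExtend, hk]
    simp only [wsum_vecWeight_succ, vecExtend_cons, e0, e1]
    have e2 := h.column m fun _ v => wsum (vecWeight wx n) fun x =>
      wsum (vecWeight (vecWeight we m) n) fun u => f fun j =>
        _root_.verticalIncrement strict (vecExtend fun i => vecExtend (u i)) (vecExtend x) (vecExtend v) n j
    -- The increment leaving the top of the column is ignored, so its sum is the total mass `1`;
    -- what remains has one column fewer.
    conv_rhs at e2 => rw [wsum_const hx, wsum_comm, ih]
    rw [← e2]
    congr 1
    funext a
    rw [wsum_comm]
    congr 1
    funext v
    rw [wsum_comm]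

end Stationary

/-! ### From weights to probability spaces -/

/-- A preimage is a countable disjoint union of measurable fibres, so `S` is arbitrary and `T` needs
no σ-algebra. -/
theorem measure_preimage_eq_wsum {Ω T : Type*} [MeasurableSpace Ω] [Countable T]
    (ν : Measure Ω) (W : Ω → T) (hW : ∀ t, MeasurableSet (W ⁻¹' {t})) (w : T → ℝ≥0∞)
    (hw : ∀ t, ν (W ⁻¹' {t}) = w t) (S : Set T) :
    ν (W ⁻¹' S) = wsum w (S.indicator 1) := by
  classical
  have h1 : W ⁻¹' S = ⋃ t : S, W ⁻¹' {(t : T)} := by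
    ext ω; simp
  rw [h1, measure_iUnion ?_ fun t : S => hW t]
  · simp only [hw, wsum]
    rw [tsum_subtype S w]
    refine tsum_congr fun t => ?_
    by_cases ht : t ∈ S <;> simp [ht]
  · intro s t hst
    refine Set.disjoint_left.2 fun ω h1 h2 => hst (Subtype.ext ?_)
    exact (Set.mem_singleton_iff.1 h1).symm.trans h2

/-- The law of a sequence of independent variables with law `w`. -/
noncomputable def iidLaw (w : PMF ℕ) : Measure (ℕ → ℕ) :=
  Measure.infinitePi fun _ : ℕ => w.toMeasure

instance (w : PMF ℕ) : IsProbabilityMeasure (iidLaw w) := by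
  unfold iidLaw; infer_instance

theorem measurableSet_restrict_preimage (m : ℕ) (v : Fin m → ℕ) :
    MeasurableSet ((fun (y : ℕ → ℕ) (j : Fin m) => y j) ⁻¹' {v}) :=
  measurableSet_preimage (by fun_prop) (measurableSet_singleton v)

theorem iidLaw_restrict_preimage (w : PMF ℕ) (m : ℕ) (v : Fin m → ℕ) :
    iidLaw w ((fun (y : ℕ → ℕ) (j : Fin m) => y j) ⁻¹' {v}) = vecWeight w m v := by
  have h1 : ((fun (y : ℕ → ℕ) (j : Fin m) => y j) ⁻¹' {v}) =
      Set.pi (Finset.range m : Set ℕ) fun j => {vecExtend v j} := by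
    ext y
    simp only [Set.mem_preimage, Set.mem_singleton_iff, funext_iff, Set.mem_pi, Finset.coe_range,
      Set.mem_Iio]
    constructor
    · intro h j hj
      have := h ⟨j, hj⟩
      simpa [vecExtend, hj] using this
    · intro h j
      rw [h j j.2, vecExtend_apply_fin]
  rw [h1, iidLaw, Measure.infinitePi_pi _ fun _ _ => measurableSet_singleton _, vecWeight,
    Finset.prod_range]
  refine Finset.prod_congr rfl fun j _ => ?_
  rw [vecExtend_apply_fin, PMF.toMeasure_apply_singleton _ _ (measurableSet_singleton _)]

/-- The weight of a cell being occupied or not. -/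
noncomputable def cellWeight (p : ℝ) (c : Bool) : ℝ≥0∞ :=
  ENNReal.ofReal (if c then p else 1 - p)

section BernoulliPoints

variable {Ω : Type*} [MeasurableSpace Ω] {μ : Measure Ω} {p : ℝ} {ξ : Ω → Set (ℕ+ × ℕ+)}

theorem IsBernoulliPointSet.measurableSet_cells (hξ : IsBernoulliPointSet μ p ξ) (i j : ℕ)
    (c : Bool) : MeasurableSet {ω | cells (ξ ω) i j = c} := by
  have h := hξ.measurableSet_mem (i.succPNat, j.succPNat)
  cases c
  · convert h.compl using 1
    ext ω
    simp [cells]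
  · convert h using 1
    ext ω
    simp [cells]

theorem IsBernoulliPointSet.measure_cells [IsProbabilityMeasure μ] (hp0 : 0 ≤ p) (hξ : IsBernoulliPointSet μ p ξ)
    (i j : ℕ) (c : Bool) : μ {ω | cells (ξ ω) i j = c} = cellWeight p c := by
  have h := hξ.measurableSet_mem (i.succPNat, j.succPNat)
  have h' := hξ.measure_mem (i.succPNat, j.succPNat)
  cases c
  · have : {ω | cells (ξ ω) i j = false} = {ω | (i.succPNat, j.succPNat) ∈ ξ ω}ᶜ := by
      ext ω
      simp [cells]
    rw [this, prob_compl_eq_one_sub h, h', cellWeight, if_neg (by simp), ENNReal.ofReal_sub _ hp0,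
      ENNReal.ofReal_one]
  · have : {ω | cells (ξ ω) i j = true} = {ω | (i.succPNat, j.succPNat) ∈ ξ ω} := by
      ext ω
      simp [cells]
    rw [this, h', cellWeight, if_pos rfl]

/-- The cells of a rectangle. -/
noncomputable def rectangleCells (n m : ℕ) (S : Set (ℕ+ × ℕ+)) (i : Fin n) (j : Fin m) : Bool :=
  cells S i j

theorem rectangleCells_preimage {Ω : Type*} {ξ : Ω → Set (ℕ+ × ℕ+)} (n m : ℕ) (A : Fin n → Fin m → Bool) :
    (fun ω => rectangleCells n m (ξ ω)) ⁻¹' {A} =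
      ⋂ q : Fin n × Fin m, {ω | cells (ξ ω) q.1 q.2 = A q.1 q.2} := by
  ext ω
  simp [funext_iff, rectangleCells]

theorem IsBernoulliPointSet.measurableSet_rectangleCells (hξ : IsBernoulliPointSet μ p ξ)
    (n m : ℕ) (A : Fin n → Fin m → Bool) :
    MeasurableSet ((fun ω => rectangleCells n m (ξ ω)) ⁻¹' {A}) := by
  rw [rectangleCells_preimage]
  exact MeasurableSet.iInter fun q => hξ.measurableSet_cells _ _ _

/-- A pattern also prescribes absent points, so independence is used for the generated σ-algebras,
which contain the complements. -/
theorem IsBernoulliPointSet.measure_rectangleCells [IsProbabilityMeasure μ] (hp0 : 0 ≤ p)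
    (hξ : IsBernoulliPointSet μ p ξ) (n m : ℕ) (A : Fin n → Fin m → Bool) :
    μ ((fun ω => rectangleCells n m (ξ ω)) ⁻¹' {A}) =
      vecWeight (vecWeight (cellWeight p) m) n A := by
  have hinj : Function.Injective fun q : Fin n × Fin m =>
      ((q.1 : ℕ).succPNat, (q.2 : ℕ).succPNat) := by
    rintro ⟨i, j⟩ ⟨i', j'⟩ h
    simp only [Prod.mk.injEq, Nat.succPNat_inj] at h
    exact Prod.ext (Fin.ext h.1) (Fin.ext h.2)
  have h := (iIndepSet_iff_iIndep _ μ).1 (hξ.indep.precomp hinj)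
  rw [rectangleCells_preimage, h.meas_iInter]
  · simp only [hξ.measure_cells hp0, vecWeight, Fintype.prod_prod_type]
  · rintro ⟨i, j⟩
    have hg := MeasurableSpace.measurableSet_generateFrom
      (Set.mem_singleton {ω | ((i : ℕ).succPNat, (j : ℕ).succPNat) ∈ ξ ω})
    cases hc : A i j
    · have : {ω | cells (ξ ω) i j = false} =
          {ω | ((i : ℕ).succPNat, (j : ℕ).succPNat) ∈ ξ ω}ᶜ := by
        ext ω
        simp [cells]
      rw [this]
      exact hg.compl
    · have : {ω | cells (ξ ω) i j = true} =
          {ω | ((i : ℕ).succPNat, (j : ℕ).succPNat) ∈ ξ ω} := by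
        ext ω
        simp [cells]
      rw [this]
      exact hg

/-- The vertical increments to the right of finitely many columns have the same law as those on
the left boundary. -/
theorem IsBernoulliPointSet.measure_verticalIncrement [IsProbabilityMeasure μ] {strict : Bool} {wx wy : PMF ℕ}
    (hp0 : 0 ≤ p) (hξ : IsBernoulliPointSet μ p ξ)
    (h : CellStationary strict wx wy (cellWeight p)) (n m : ℕ) (S : Set (Fin m → ℕ)) :
    (μ.prod ((iidLaw wx).prod (iidLaw wy)))
      {q | (fun j : Fin m => verticalIncrement strict (cells (ξ q.1)) q.2.1 q.2.2 n j) ∈ S} =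
    iidLaw wy {y | (fun j : Fin m => y j) ∈ S} := by
  have h1 := measure_preimage_eq_wsum (iidLaw wy) (fun y (j : Fin m) => y j)
    (measurableSet_restrict_preimage m) _ (iidLaw_restrict_preimage wy m) S
  have h2 := measure_preimage_eq_wsum (μ.prod ((iidLaw wx).prod (iidLaw wy)))
    (fun q => (fun i : Fin n => q.2.1 i, fun j : Fin m => q.2.2 j, rectangleCells n m (ξ q.1)))
    (T := (Fin n → ℕ) × (Fin m → ℕ) × (Fin n → Fin m → Bool))
    (w := fun t => vecWeight wx n t.1 * (vecWeight wy m t.2.1 *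
      vecWeight (vecWeight (cellWeight p) m) n t.2.2))
  have hset : ∀ t : (Fin n → ℕ) × (Fin m → ℕ) × (Fin n → Fin m → Bool),
      (fun q : Ω × (ℕ → ℕ) × (ℕ → ℕ) =>
        (fun i : Fin n => q.2.1 i, fun j : Fin m => q.2.2 j, rectangleCells n m (ξ q.1))) ⁻¹' {t} =
      ((fun ω => rectangleCells n m (ξ ω)) ⁻¹' {t.2.2}) ×ˢ
        (((fun (y : ℕ → ℕ) (j : Fin n) => y j) ⁻¹' {t.1}) ×ˢ
          ((fun (y : ℕ → ℕ) (j : Fin m) => y j) ⁻¹' {t.2.1})) := by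
    rintro ⟨u, v, A⟩
    ext q
    simp only [Set.mem_preimage, Set.mem_singleton_iff, Prod.mk.injEq, Set.mem_prod]
    tauto
  have h3 := h2 (fun t => by
      rw [hset]
      exact (hξ.measurableSet_rectangleCells n m _).prod
        ((measurableSet_restrict_preimage n _).prod (measurableSet_restrict_preimage m _)))
    (fun t => by
      rw [hset, Measure.prod_prod, Measure.prod_prod, hξ.measure_rectangleCells hp0,
        iidLaw_restrict_preimage, iidLaw_restrict_preimage]
      ring)
    {t | (fun j : Fin m => verticalIncrement strict (vecExtend fun i => vecExtend (t.2.2 i))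
      (vecExtend t.1) (vecExtend t.2.1) n j) ∈ S}
  have h4 : {q : Ω × (ℕ → ℕ) × (ℕ → ℕ) |
      (fun j : Fin m => verticalIncrement strict (cells (ξ q.1)) q.2.1 q.2.2 n j) ∈ S} =
      (fun q : Ω × (ℕ → ℕ) × (ℕ → ℕ) =>
        (fun i : Fin n => q.2.1 i, fun j : Fin m => q.2.2 j, rectangleCells n m (ξ q.1))) ⁻¹'
      {t | (fun j : Fin m => verticalIncrement strict (vecExtend fun i => vecExtend (t.2.2 i))
        (vecExtend t.1) (vecExtend t.2.1) n j) ∈ S} := by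
    ext q
    simp only [Set.mem_ofPred_eq, Set.mem_preimage]
    have : (fun j : Fin m => verticalIncrement strict (cells (ξ q.1)) q.2.1 q.2.2 n j) =
        fun j : Fin m => verticalIncrement strict
          (vecExtend fun i => vecExtend (rectangleCells n m (ξ q.1) i))
          (vecExtend fun i : Fin n => q.2.1 i) (vecExtend fun j : Fin m => q.2.2 j) n j := by
      funext j
      refine verticalIncrement_congr (fun i hi j hj => ?_) (fun i hi => ?_) (fun j hj => ?_) j.2
      · simp [vecExtend, hi, hj, rectangleCells]
      · simp [vecExtend, hi]
      · simp [vecExtend, hj]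
    rw [this]
  rw [h4, h3]
  refine Eq.trans ?_ h1.symm
  rw [← h.verticalIncrement wx.tsum_coe n m]
  simp only [wsum]
  rw [ENNReal.tsum_prod']
  refine tsum_congr fun u => ?_
  rw [ENNReal.tsum_prod', ← ENNReal.tsum_mul_left]
  refine tsum_congr fun v => ?_
  rw [← ENNReal.tsum_mul_left, ← ENNReal.tsum_mul_left]
  refine tsum_congr fun A => ?_
  simp only [mul_assoc]
  rfl

end BernoulliPoints

/-! ### Concentration of sums of independent increments -/

/-- Exponential moment bounds showing that `w` is concentrated around `β`. -/
def ConcentratedAt (w : ℕ → ℝ≥0∞) (β : ℝ) : Prop :=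
  ∀ ε > 0, (∃ t > 0, wsum w (fun k => ENNReal.ofReal (Real.exp (t * k))) ≤
      ENNReal.ofReal (Real.exp (t * (β + ε)))) ∧
    (∃ t > 0, wsum w (fun k => ENNReal.ofReal (Real.exp (-t * k))) ≤
      ENNReal.ofReal (Real.exp (-t * (β - ε))))

/-- Chernoff's bound; since `t` may have either sign, it covers both tails. -/
theorem iidLaw_sum_tail_le (w : PMF ℕ) {t r : ℝ}
    (h : wsum w (fun k => ENNReal.ofReal (Real.exp (t * k))) ≤ ENNReal.ofReal (Real.exp r))
    (m : ℕ) (c : ℝ) :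
    iidLaw w {y | c ≤ t * ((∑ l ∈ Finset.range m, y l : ℕ) : ℝ)} ≤
      ENNReal.ofReal (Real.exp (m * r - c)) := by
  have h1 := measure_preimage_eq_wsum (iidLaw w) (fun y (j : Fin m) => y j)
    (measurableSet_restrict_preimage m) _ (iidLaw_restrict_preimage w m)
    {v | c ≤ t * ((∑ l, v l : ℕ) : ℝ)}
  have h2 : {y : ℕ → ℕ | c ≤ t * ((∑ l ∈ Finset.range m, y l : ℕ) : ℝ)} =
      (fun y (j : Fin m) => y j) ⁻¹' {v : Fin m → ℕ | c ≤ t * ((∑ l, v l : ℕ) : ℝ)} := by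
    ext y
    simp [Finset.sum_range]
  rw [h2, h1]
  calc wsum (vecWeight w m) (Set.indicator {v | c ≤ t * ((∑ l, v l : ℕ) : ℝ)} 1)
      ≤ wsum (vecWeight w m) (fun v => ENNReal.ofReal (Real.exp (-c)) *
          ∏ j, ENNReal.ofReal (Real.exp (t * (v j : ℝ)))) := by
        refine wsum_mono _ fun v => ?_
        by_cases hv : v ∈ {v : Fin m → ℕ | c ≤ t * ((∑ l, v l : ℕ) : ℝ)}
        · rw [Set.indicator_of_mem hv, Pi.one_apply,
            ← ENNReal.ofReal_prod_of_nonneg fun _ _ => (Real.exp_pos _).le, ← Real.exp_sum,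
            ← ENNReal.ofReal_mul (Real.exp_pos _).le, ← Real.exp_add, ← Finset.mul_sum,
            ENNReal.one_le_ofReal, Real.one_le_exp_iff]
          have : c ≤ t * ((∑ l, v l : ℕ) : ℝ) := hv
          push_cast at this
          linarith
        · rw [Set.indicator_of_notMem hv]
          exact zero_le
    _ ≤ ENNReal.ofReal (Real.exp (m * r - c)) := by
        rw [wsum_mul_left, wsum_vecWeight_prod w fun k : ℕ => ENNReal.ofReal (Real.exp (t * k))]
        calc _ ≤ ENNReal.ofReal (Real.exp (-c)) * ENNReal.ofReal (Real.exp r) ^ m := by gcongr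
          _ = _ := by
            rw [← ENNReal.ofReal_pow (Real.exp_pos _).le, ← ENNReal.ofReal_mul (Real.exp_pos _).le,
              ← Real.exp_nat_mul, ← Real.exp_add]
            congr 2
            ring

theorem tsum_ofReal_exp_ne_top {c : ℝ} (hc : 0 < c) :
    ∑' n : ℕ, ENNReal.ofReal (Real.exp (-(c * n))) ≠ ∞ := by
  have : Summable fun n : ℕ => Real.exp (-(c * n)) := by
    have h := Real.summable_exp_nat_mul_iff.2 (neg_lt_zero.2 hc)
    refine h.congr fun n => ?_
    congr 1
    ring
  exact this.tsum_ofReal_ne_top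

theorem ConcentratedAt.tsum_ne_top {w : PMF ℕ} {β : ℝ} (hw : ConcentratedAt w β) {k : ℕ → ℕ}
    {C : ℝ} (hC : 0 < C) (hk : ∀ n, (k n : ℝ) ≤ C * n) {δ : ℝ} (hδ : 0 < δ) :
    ∑' n : ℕ, iidLaw w
      {y | δ * n ≤ |((∑ l ∈ Finset.range (k n), y l : ℕ) : ℝ) - β * k n|} ≠ ∞ := by
  -- With `k n ≤ C n` this tolerance uses up half of the deviation `δ n`; the other half gives the
  -- exponential decay.
  obtain ⟨⟨t, ht, h1⟩, ⟨s, hs, h2⟩⟩ := hw (δ / (2 * C)) (by positivity)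
  have hkn : ∀ n, δ / (2 * C) * k n ≤ δ / 2 * n := by
    intro n
    calc δ / (2 * C) * k n ≤ δ / (2 * C) * (C * n) := by gcongr; exact hk n
      _ = δ / 2 * n := by field_simp
  have hb : ∀ n : ℕ, iidLaw w
      {y | δ * n ≤ |((∑ l ∈ Finset.range (k n), y l : ℕ) : ℝ) - β * k n|} ≤
      ENNReal.ofReal (Real.exp (-(t * δ / 2 * n))) +
        ENNReal.ofReal (Real.exp (-(s * δ / 2 * n))) := by
    intro n
    calc _ ≤ iidLaw w ({y | t * (β * k n + δ * n) ≤ t * ((∑ l ∈ Finset.range (k n), y l : ℕ) : ℝ)} ∪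
          {y | -s * (β * k n - δ * n) ≤ -s * ((∑ l ∈ Finset.range (k n), y l : ℕ) : ℝ)}) := by
          refine measure_mono fun y hy => ?_
          have hy' : δ * n ≤ |((∑ l ∈ Finset.range (k n), y l : ℕ) : ℝ) - β * k n| := hy
          rcases le_abs.1 hy' with h | h
          · exact Or.inl (mul_le_mul_of_nonneg_left (by linarith) ht.le)
          · have h' : ((∑ l ∈ Finset.range (k n), y l : ℕ) : ℝ) ≤ β * k n - δ * n := by linarith
            exact Or.inr (mul_le_mul_of_nonpos_left h' (neg_nonpos.2 hs.le))
      _ ≤ _ := (measure_union_le _ _).trans (add_le_add (iidLaw_sum_tail_le w h1 _ _)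
          (iidLaw_sum_tail_le w h2 _ _))
      _ ≤ _ := by
          refine add_le_add (ENNReal.ofReal_le_ofReal (Real.exp_le_exp.2 ?_))
            (ENNReal.ofReal_le_ofReal (Real.exp_le_exp.2 ?_))
          · nlinarith [mul_le_mul_of_nonneg_left (hkn n) ht.le]
          · nlinarith [mul_le_mul_of_nonneg_left (hkn n) hs.le]
  refine ne_top_of_le_ne_top ?_ (ENNReal.tsum_le_tsum hb)
  rw [ENNReal.tsum_add]
  exact ENNReal.add_ne_top.2 ⟨tsum_ofReal_exp_ne_top (by positivity),
    tsum_ofReal_exp_ne_top (by positivity)⟩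

/-- Borel–Cantelli with summable tails needs only the law of each `Z n`, not their joint law. This
matters because the column whose vertical increments are summed moves with `n`. -/
theorem ConcentratedAt.ae_tendsto {Ω : Type*} [MeasurableSpace Ω] {ν : Measure Ω} {w : PMF ℕ}
    {β : ℝ} (hw : ConcentratedAt w β) {k : ℕ → ℕ} {C : ℝ} (hC : 0 < C)
    (hk : ∀ n, (k n : ℝ) ≤ C * n) (Z : ℕ → Ω → ℕ)
    (hZ : ∀ n (B : Set ℕ), ν {ω | Z n ω ∈ B} = iidLaw w {y | ∑ l ∈ Finset.range (k n), y l ∈ B}) :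
    ∀ᵐ ω ∂ν, Tendsto (fun n : ℕ => ((Z n ω : ℝ) - β * k n) / n) atTop (𝓝 0) := by
  have h : ∀ r : ℕ, ∀ᵐ ω ∂ν, ∀ᶠ n : ℕ in atTop,
      ¬ (1 / ((r : ℝ) + 1) * n ≤ |(Z n ω : ℝ) - β * k n|) := by
    intro r
    refine ae_eventually_notMem (s := fun n : ℕ =>
      {ω | 1 / ((r : ℝ) + 1) * n ≤ |(Z n ω : ℝ) - β * k n|}) ?_
    have := hw.tsum_ne_top hC hk (δ := 1 / ((r : ℝ) + 1)) (by positivity)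
    convert this using 4 with n
    exact hZ n {z | 1 / ((r : ℝ) + 1) * n ≤ |(z : ℝ) - β * k n|}
  filter_upwards [ae_all_iff.2 h] with ω hω
  refine Metric.tendsto_nhds.2 fun ε hε => ?_
  obtain ⟨r, hr⟩ := exists_nat_one_div_lt hε
  filter_upwards [hω r, eventually_gt_atTop 0] with n hn hn0
  have hn0' : (0 : ℝ) < n := by exact_mod_cast hn0
  rw [Real.dist_eq, sub_zero, abs_div, abs_of_pos hn0', div_lt_iff₀ hn0']
  exact (not_le.1 hn).trans (mul_lt_mul_of_pos_right hr hn0')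

theorem tendsto_floor_mul_div {a : ℝ} (ha : 0 ≤ a) :
    Tendsto (fun n : ℕ => (⌊a * (n : ℝ)⌋₊ : ℝ) / n) atTop (𝓝 a) :=
  (tendsto_nat_floor_mul_div_atTop ha).comp tendsto_natCast_atTop_atTop

/-- Boundary sequences of densities `α`, `β` along which the last passage values in direction
`(a, b)` grow linearly at rate `a α + b β`. -/
def HasStationaryBoundary (strict : Bool) (e : ℕ → ℕ → Bool) (a b α β : ℝ) : Prop :=
  ∃ x y : ℕ → ℕ,
    Tendsto (fun n : ℕ => ((∑ k ∈ Finset.range n, x k : ℕ) : ℝ) / n) atTop (𝓝 α) ∧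
    Tendsto (fun n : ℕ => ((∑ k ∈ Finset.range n, y k : ℕ) : ℝ) / n) atTop (𝓝 β) ∧
    Tendsto (fun n : ℕ =>
      (lastPassage strict e x y ⌊a * (n : ℝ)⌋₊ ⌊b * (n : ℝ)⌋₊ : ℝ) / n) atTop (𝓝 (a * α + b * β))

theorem IsBernoulliPointSet.ae_hasStationaryBoundary {Ω : Type*} [MeasurableSpace Ω]
    {μ : Measure Ω} [IsProbabilityMeasure μ] {p : ℝ} {ξ : Ω → Set (ℕ+ × ℕ+)} (hp0 : 0 ≤ p)
    (hξ : IsBernoulliPointSet μ p ξ) {strict : Bool} {wx wy : PMF ℕ}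
    (h : CellStationary strict wx wy (cellWeight p)) {α β : ℝ} (hx : ConcentratedAt wx α)
    (hy : ConcentratedAt wy β) {a b : ℝ} (ha : 0 < a) (hb : 0 < b) :
    ∀ᵐ ω ∂μ, HasStationaryBoundary strict (cells (ξ ω)) a b α β := by
  have hfl : ∀ c : ℝ, 0 < c → ∀ n : ℕ, (⌊c * (n : ℝ)⌋₊ : ℝ) ≤ c * n := fun c hc n =>
    Nat.floor_le (by positivity)
  have hmeas : ∀ (k : ℕ) (B : Set ℕ), MeasurableSet {y : ℕ → ℕ | ∑ l ∈ Finset.range k, y l ∈ B} :=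
    fun k B => measurableSet_preimage (by fun_prop) (MeasurableSet.of_discrete (s := B))
  have hX : ∀ (k : ℕ) (B : Set ℕ), (μ.prod ((iidLaw wx).prod (iidLaw wy)))
      {q | ∑ l ∈ Finset.range k, q.2.1 l ∈ B} =
      iidLaw wx {y | ∑ l ∈ Finset.range k, y l ∈ B} := by
    intro k B
    have : {q : Ω × (ℕ → ℕ) × (ℕ → ℕ) | ∑ l ∈ Finset.range k, q.2.1 l ∈ B} =
        Set.univ ×ˢ ({y | ∑ l ∈ Finset.range k, y l ∈ B} ×ˢ Set.univ) := by ext; simp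
    rw [this, Measure.prod_prod, Measure.prod_prod]
    simp
  have hY : ∀ (k : ℕ) (B : Set ℕ), (μ.prod ((iidLaw wx).prod (iidLaw wy)))
      {q | ∑ l ∈ Finset.range k, q.2.2 l ∈ B} =
      iidLaw wy {y | ∑ l ∈ Finset.range k, y l ∈ B} := by
    intro k B
    have : {q : Ω × (ℕ → ℕ) × (ℕ → ℕ) | ∑ l ∈ Finset.range k, q.2.2 l ∈ B} =
        Set.univ ×ˢ (Set.univ ×ˢ {y | ∑ l ∈ Finset.range k, y l ∈ B}) := by ext; simp
    rw [this, Measure.prod_prod, Measure.prod_prod]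
    simp
  have hV : ∀ (n m : ℕ) (B : Set ℕ), (μ.prod ((iidLaw wx).prod (iidLaw wy)))
      {q | ∑ l ∈ Finset.range m, verticalIncrement strict (cells (ξ q.1)) q.2.1 q.2.2 n l ∈ B} =
      iidLaw wy {y | ∑ l ∈ Finset.range m, y l ∈ B} := by
    intro n m B
    have := hξ.measure_verticalIncrement hp0 h n m {v | ∑ j, v j ∈ B}
    simpa [Finset.sum_range] using this
  have key : ∀ᵐ q ∂(μ.prod ((iidLaw wx).prod (iidLaw wy))),
      HasStationaryBoundary strict (cells (ξ q.1)) a b α β := by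
    filter_upwards [
      hx.ae_tendsto (k := fun n => n) one_pos (fun n => by simp)
        (fun n q => ∑ l ∈ Finset.range n, q.2.1 l) (fun n B => hX n B),
      hy.ae_tendsto (k := fun n => n) one_pos (fun n => by simp)
        (fun n q => ∑ l ∈ Finset.range n, q.2.2 l) (fun n B => hY n B),
      hx.ae_tendsto (k := fun n => ⌊a * (n : ℝ)⌋₊) ha (hfl a ha)
        (fun n q => ∑ l ∈ Finset.range ⌊a * (n : ℝ)⌋₊, q.2.1 l) (fun n B => hX _ B),
      hy.ae_tendsto (k := fun n => ⌊b * (n : ℝ)⌋₊) hb (hfl b hb)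
        (fun n q => ∑ l ∈ Finset.range ⌊b * (n : ℝ)⌋₊,
          verticalIncrement strict (cells (ξ q.1)) q.2.1 q.2.2 ⌊a * (n : ℝ)⌋₊ l)
        (fun n B => hV _ _ B)] with q h1 h2 h3 h4
    have aux : ∀ (S : ℕ → ℕ) (ρ : ℝ), Tendsto (fun n : ℕ => ((S n : ℝ) - ρ * n) / n) atTop (𝓝 0) →
        Tendsto (fun n : ℕ => (S n : ℝ) / n) atTop (𝓝 ρ) := by
      intro S ρ hS
      have := hS.add_const ρ
      rw [zero_add] at this
      refine this.congr' ?_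
      filter_upwards [eventually_gt_atTop 0] with n hn
      have : (n : ℝ) ≠ 0 := by positivity
      field_simp
      ring
    refine ⟨q.2.1, q.2.2, aux _ _ h1, aux _ _ h2, ?_⟩
    have := (h3.add h4).add (((tendsto_floor_mul_div ha.le).mul_const α).add
      ((tendsto_floor_mul_div hb.le).mul_const β))
    rw [add_zero, zero_add] at this
    refine this.congr fun n => ?_
    rw [lastPassage, Nat.cast_add]
    ring
  -- The boundary is now hidden in an existential, so Fubini turns `key` into a statement about the
  -- points alone. Different densities can then be compared at the same `ω` without any coupling.
  filter_upwards [Measure.ae_ae_of_ae_prod key] with ω hω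
  exact hω.exists.choose_spec

/-! ### Bounds from stationary boundaries -/

/-- If `S n / n → α` then `S k` is within `δ n` of `α k`, uniformly over `k ≤ C n`. -/
theorem eventually_forall_abs_sub_le {S : ℕ → ℝ} {α : ℝ}
    (h : Tendsto (fun n : ℕ => S n / n) atTop (𝓝 α)) {C δ : ℝ} (hC : 0 < C) (hδ : 0 < δ) :
    ∀ᶠ n : ℕ in atTop, ∀ k : ℕ, (k : ℝ) ≤ C * n → |S k - α * k| ≤ δ * n := by
  obtain ⟨K, hK⟩ := eventually_atTop.1 (Metric.tendsto_nhds.1 h (δ / C) (by positivity))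
  have hlim : Tendsto (fun n : ℕ => δ * (n : ℝ)) atTop atTop :=
    tendsto_natCast_atTop_atTop.const_mul_atTop hδ
  -- The finitely many small `k` contribute a constant, eventually below `δ n`.
  filter_upwards [hlim.eventually_ge_atTop (∑ k ∈ Finset.range (K + 1), |S k - α * k|)] with n hn k hk
  rcases lt_or_ge k (K + 1) with hkK | hkK
  · exact (Finset.single_le_sum (f := fun k : ℕ => |S k - α * k|) (fun _ _ => abs_nonneg _)
      (Finset.mem_range.2 hkK)).trans hn
  · have h1 := hK k (by omega)
    have hk0 : (0 : ℝ) < k := by exact_mod_cast (by omega : 0 < k)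
    have h2 : S k - α * k = (S k / k - α) * k := by field_simp
    rw [h2, abs_mul, abs_of_pos hk0]
    rw [Real.dist_eq] at h1
    calc |S k / k - α| * k ≤ δ / C * k := by gcongr
      _ ≤ δ / C * (C * n) := by gcongr
      _ = δ * n := by field_simp

theorem eventually_forall_abs_succ_sub_le {S : ℕ → ℝ} {α : ℝ}
    (h : Tendsto (fun n : ℕ => S n / n) atTop (𝓝 α)) {C δ : ℝ} (hC : 0 < C) (hδ : 0 < δ) :
    ∀ᶠ n : ℕ in atTop, ∀ k : ℕ, (k : ℝ) ≤ C * n → |S (k + 1) - α * k| ≤ δ * n := by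
  have hlim : Tendsto (fun n : ℕ => δ / 2 * (n : ℝ)) atTop atTop :=
    tendsto_natCast_atTop_atTop.const_mul_atTop (by positivity)
  filter_upwards [eventually_forall_abs_sub_le h (by positivity : 0 < C + 1) (half_pos hδ),
    hlim.eventually_ge_atTop |α|, eventually_ge_atTop 1] with n h1 h2 h3 k hk
  have h3' : (1 : ℝ) ≤ n := by exact_mod_cast h3
  have h4 := h1 (k + 1) (by push_cast; linarith)
  have h5 : S (k + 1) - α * k = (S (k + 1) - α * (k + 1 : ℕ)) + α := by push_cast; ring
  rw [h5]
  calc _ ≤ |S (k + 1) - α * (k + 1 : ℕ)| + |α| := abs_add_le _ _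
    _ ≤ δ / 2 * n + δ / 2 * n := add_le_add h4 h2
    _ = δ * n := by ring

/-- Comparison with a boundary of higher density shows that paths leave the boundary early. -/
theorem eventually_exit_lt {S S' G G' : ℕ → ℝ} {α α' g g' C ε : ℝ}
    (hS : Tendsto (fun n : ℕ => S n / n) atTop (𝓝 α))
    (hS' : Tendsto (fun n : ℕ => S' n / n) atTop (𝓝 α'))
    (hG : Tendsto (fun n : ℕ => G n / n) atTop (𝓝 g))
    (hG' : Tendsto (fun n : ℕ => G' n / n) atTop (𝓝 g'))
    (hC : 0 < C) (hα : α < α') (hlt : g' - g < ε * (α' - α)) :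
    ∀ᶠ n : ℕ in atTop, ∀ k : ℕ, (k : ℝ) ≤ C * n → G n - G' n ≤ S (k + 1) - S' k →
      (k : ℝ) < ε * n := by
  -- A quarter of the gap: three errors `δ n` come from `S`, `S'` and `G' - G`, and one remains for
  -- strictness.
  set δ := (ε * (α' - α) - (g' - g)) / 4 with hδ
  have hδ0 : 0 < δ := by rw [hδ]; linarith
  filter_upwards [eventually_forall_abs_succ_sub_le hS hC hδ0,
    eventually_forall_abs_sub_le hS' hC hδ0,
    (tendsto_order.1 (hG'.sub hG)).2 (g' - g + δ) (by linarith), eventually_gt_atTop 0]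
    with n h1 h2 h3 h4 k hk hle
  have hn : (0 : ℝ) < n := by exact_mod_cast h4
  have h5 := (abs_le.1 (h1 k hk)).2
  have h6 := (abs_le.1 (h2 k hk)).1
  rw [← sub_div, div_lt_iff₀ hn] at h3
  have h7 : 0 < α' - α := sub_pos.2 hα
  by_contra hcon
  have h8 := mul_le_mul_of_nonneg_left (not_lt.1 hcon) h7.le
  have h9 : 4 * δ * n = (ε * (α' - α) - (g' - g)) * n := by rw [hδ]; ring
  have h10 := mul_pos hδ0 hn
  linarith

section Directions

variable {strict : Bool} {e : ℕ → ℕ → Bool} {a b α β : ℝ}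

theorem HasStationaryBoundary.eventually_le (h : HasStationaryBoundary strict e a b α β)
    {ε : ℝ} (hε : 0 < ε) :
    ∀ᶠ n : ℕ in atTop, (lastPassage strict e 0 0 ⌊a * (n : ℝ)⌋₊ ⌊b * (n : ℝ)⌋₊ : ℝ) ≤
      (a * α + b * β + ε) * n := by
  obtain ⟨x, y, -, -, hG⟩ := h
  filter_upwards [(tendsto_order.1 hG).2 (a * α + b * β + ε) (by linarith), eventually_gt_atTop 0]
    with n h1 h2
  have hn : (0 : ℝ) < n := by exact_mod_cast h2
  rw [div_lt_iff₀ hn] at h1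
  refine le_trans ?_ h1.le
  exact_mod_cast lastPassage_zero_boundary_le strict e x y _ _

/-- Each of `hx` and `hy` supplies a boundary whose density gain on one side is large compared with
its rate gain, which bounds the exit point on that side by `ε n`. The boundary part of the optimal
path is then at most about `ε α n` or `ε β n`. -/
theorem HasStationaryBoundary.eventually_ge (h : HasStationaryBoundary strict e a b α β)
    (ha : 0 < a) (hb : 0 < b) (hα : 0 ≤ α) (hβ : 0 ≤ β) {ε : ℝ} (hε : 0 < ε)
    (hx : ∃ α' β', HasStationaryBoundary strict e a b α' β' ∧ α < α' ∧
      a * α' + b * β' - (a * α + b * β) < ε * (α' - α))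
    (hy : ∃ α' β', HasStationaryBoundary strict e a b α' β' ∧ β < β' ∧
      a * α' + b * β' - (a * α + b * β) < ε * (β' - β)) :
    ∀ᶠ n : ℕ in atTop, (a * α + b * β - ε * (α + β + 1)) * n ≤
      (lastPassage strict e 0 0 ⌊a * (n : ℝ)⌋₊ ⌊b * (n : ℝ)⌋₊ : ℝ) := by
  obtain ⟨x, y, hX, hY, hG⟩ := h
  obtain ⟨α₁, β₁, ⟨x₁, y₁, hX₁, -, hG₁⟩, hα₁, hlt₁⟩ := hx
  obtain ⟨α₂, β₂, ⟨x₂, y₂, -, hY₂, hG₂⟩, hβ₂, hlt₂⟩ := hy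
  filter_upwards [eventually_exit_lt hX hX₁ hG hG₁ ha hα₁ hlt₁,
    eventually_exit_lt hY hY₂ hG hG₂ hb hβ₂ hlt₂,
    eventually_forall_abs_succ_sub_le hX ha (half_pos hε),
    eventually_forall_abs_succ_sub_le hY hb (half_pos hε),
    (tendsto_order.1 hG).1 (a * α + b * β - ε / 2) (by linarith), eventually_gt_atTop 0]
    with n h1 h2 h3 h4 h5 h6
  have hn : (0 : ℝ) < n := by exact_mod_cast h6
  rw [lt_div_iff₀ hn] at h5
  have hfa : (⌊a * (n : ℝ)⌋₊ : ℝ) ≤ a * n := Nat.floor_le (by positivity)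
  have hfb : (⌊b * (n : ℝ)⌋₊ : ℝ) ≤ b * n := Nat.floor_le (by positivity)
  generalize ⌊a * (n : ℝ)⌋₊ = N at *
  generalize ⌊b * (n : ℝ)⌋₊ = M at *
  have hεα : 0 ≤ ε * α * n := by positivity
  have hεβ : 0 ≤ ε * β * n := by positivity
  rcases exists_exit strict e x y N M with ⟨k, i', rfl, hle⟩ | ⟨k, j', rfl, hle⟩
  · have hk : (k : ℝ) ≤ a * n := le_trans (by push_cast; linarith [i'.cast_nonneg (α := ℝ)]) hfa
    have hle' : lastPassage strict e x y (k + i') M ≤ ∑ r ∈ Finset.range (k + 1), x r +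
        lastPassage strict (fun i => e (k + i)) 0 0 i' M :=
      hle.trans (by gcongr; omega)
    -- The competing boundary is left at the same `k`, so the bulk terms cancel and only the two
    -- boundary sums are compared.
    have h7 := sum_add_lastPassage_le_bottom strict e x₁ y₁ k i' M
    have h8 := lastPassage_bottom_shift_le strict e k i' M
    rify at hle' h7 h8
    have h9 := h1 k hk (by push_cast; linarith)
    have h10 := (abs_le.1 (h3 k hk)).2
    push_cast at h10
    have h11 := mul_le_mul_of_nonneg_left h9.le hα
    push_cast at *
    linarith
  · have hk : (k : ℝ) ≤ b * n :=
      le_trans (by push_cast; linarith [j'.cast_nonneg (α := ℝ)]) hfb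
    have h7 := sum_add_lastPassage_le_left strict e x₂ y₂ k N (j' + 1)
    have h8 := lastPassage_left_shift_le strict e k N (j' + 1)
    rify at hle h7 h8
    have h9 := h2 k hk (by push_cast; linarith)
    have h10 := (abs_le.1 (h4 k hk)).2
    push_cast at h10
    have h11 := mul_le_mul_of_nonneg_left h9.le hβ
    push_cast at *
    linarith

end Directions

/-! ### Bernoulli and geometric increments -/

/-- At `0` the bound `φ` and `exp (t c)` agree with slopes `β` and `c`; for `c = β ± ε` the
exponential wins for small `t` of the sign of `c - β`. -/
theorem concentratedAt_of_hasDerivAt {w : ℕ → ℝ≥0∞} {β : ℝ} {φ : ℝ → ℝ} (h0 : φ 0 = 1)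
    (hφ : HasDerivAt φ β 0)
    (hw : ∀ᶠ t in 𝓝 (0 : ℝ), wsum w (fun k => ENNReal.ofReal (Real.exp (t * k))) ≤
      ENNReal.ofReal (φ t)) : ConcentratedAt w β := by
  have hd : ∀ c : ℝ, Tendsto (slope (fun t => φ t - Real.exp (t * c)) 0) (𝓝[≠] 0) (𝓝 (β - c)) := by
    intro c
    refine hasDerivAt_iff_tendsto_slope.1 ?_
    have h1 : HasDerivAt (fun t : ℝ => Real.exp (t * c)) (Real.exp (0 * c) * (1 * c)) 0 :=
      ((hasDerivAt_id (0 : ℝ)).mul_const c).exp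
    have h2 := hφ.sub h1
    simp only [zero_mul, Real.exp_zero, one_mul] at h2
    exact h2
  intro ε hε
  constructor
  · have h1 := (hd (β + ε)).mono_left (nhdsWithin_mono 0 fun t (ht : t ∈ Set.Ioi (0 : ℝ)) => ht.ne')
    obtain ⟨t, ⟨h2, h3⟩, ht⟩ := (((tendsto_order.1 h1).2 0 (by linarith)).and
      (nhdsWithin_le_nhds hw)).and self_mem_nhdsWithin |>.exists
    have ht0 : 0 < t := ht
    refine ⟨t, ht0, h3.trans (ENNReal.ofReal_le_ofReal ?_)⟩
    simp only [slope, h0, zero_mul, Real.exp_zero, sub_self, vsub_eq_sub, sub_zero,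
      smul_eq_mul] at h2
    have := neg_of_mul_neg_right h2 (inv_pos.2 ht0).le
    linarith
  · have h1 := (hd (β - ε)).mono_left (nhdsWithin_mono 0 fun t (ht : t ∈ Set.Iio (0 : ℝ)) => ht.ne)
    obtain ⟨t, ⟨h2, h3⟩, ht⟩ := (((tendsto_order.1 h1).1 0 (by linarith)).and
      (nhdsWithin_le_nhds hw)).and self_mem_nhdsWithin |>.exists
    have ht0 : t < 0 := ht
    refine ⟨-t, neg_pos.2 ht0, ?_⟩
    rw [neg_neg]
    refine h3.trans (ENNReal.ofReal_le_ofReal ?_)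
    simp only [slope, h0, zero_mul, Real.exp_zero, sub_self, vsub_eq_sub, sub_zero,
      smul_eq_mul] at h2
    have := neg_of_mul_pos_right h2 (inv_lt_zero.2 ht0).le
    linarith

/-- The weight of a Bernoulli variable on `ℕ`. -/
noncomputable def bernoulliWeight (α : ℝ) : ℕ → ℝ≥0∞
  | 0 => ENNReal.ofReal (1 - α)
  | 1 => ENNReal.ofReal α
  | _ + 2 => 0

theorem wsum_bernoulliWeight (α : ℝ) (f : ℕ → ℝ≥0∞) :
    wsum (bernoulliWeight α) f = ENNReal.ofReal (1 - α) * f 0 + ENNReal.ofReal α * f 1 := by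
  rw [wsum, tsum_eq_sum (s := Finset.range 2)]
  · simp [Finset.sum_range_succ, bernoulliWeight]
  · intro k hk
    obtain ⟨k, rfl⟩ : ∃ r, k = r + 2 := ⟨k - 2, by simp at hk; omega⟩
    simp [bernoulliWeight]

theorem ofReal_one_sub_add {α : ℝ} (h0 : 0 ≤ α) (h1 : α ≤ 1) :
    ENNReal.ofReal (1 - α) + ENNReal.ofReal α = 1 := by
  rw [← ENNReal.ofReal_add (by linarith) h0]
  simp

theorem tsum_bernoulliWeight {α : ℝ} (h0 : 0 ≤ α) (h1 : α ≤ 1) :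
    ∑' k, bernoulliWeight α k = 1 := by
  have := wsum_bernoulliWeight α fun _ => 1
  simpa [wsum, ofReal_one_sub_add h0 h1] using this

/-- A Bernoulli variable on `ℕ`. -/
noncomputable def bernoulliNat (α : ℝ) (h0 : 0 ≤ α) (h1 : α ≤ 1) : PMF ℕ :=
  ⟨bernoulliWeight α, ENNReal.summable.hasSum_iff.2 (tsum_bernoulliWeight h0 h1)⟩

theorem concentratedAt_bernoulliWeight {α : ℝ} (h0 : 0 ≤ α) (h1 : α ≤ 1) :
    ConcentratedAt (bernoulliWeight α) α := by
  refine concentratedAt_of_hasDerivAt (φ := fun t => 1 - α + α * Real.exp t) (by simp) ?_ ?_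
  · simpa using ((Real.hasDerivAt_exp 0).const_mul α).const_add (1 - α)
  · refine Eventually.of_forall fun t => ?_
    rw [wsum_bernoulliWeight, ENNReal.ofReal_add (by linarith) (by positivity),
      ENNReal.ofReal_mul h0]
    simp

/-- The weight of a geometric variable on `ℕ`. -/
noncomputable def geometricWeight (γ : ℝ) (k : ℕ) : ℝ≥0∞ := ENNReal.ofReal ((1 - γ) * γ ^ k)

theorem wsum_geometricWeight_exp {γ : ℝ} (h0 : 0 ≤ γ) (h1 : γ < 1) {t : ℝ}
    (ht : γ * Real.exp t < 1) :
    wsum (geometricWeight γ) (fun k => ENNReal.ofReal (Real.exp (t * k))) =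
      ENNReal.ofReal ((1 - γ) / (1 - γ * Real.exp t)) := by
  have h2 : 0 ≤ γ * Real.exp t := by positivity
  have h3 : 0 ≤ 1 - γ := by linarith
  rw [div_eq_mul_inv, ← tsum_geometric_of_lt_one h2 ht, ← tsum_mul_left,
    ENNReal.ofReal_tsum_of_nonneg (fun n => by positivity)
      ((summable_geometric_of_lt_one h2 ht).mul_left _), wsum]
  refine tsum_congr fun k => ?_
  rw [geometricWeight, ← ENNReal.ofReal_mul (by positivity)]
  congr 1
  rw [mul_comm t, Real.exp_nat_mul]
  ring

theorem tsum_geometricWeight {γ : ℝ} (h0 : 0 ≤ γ) (h1 : γ < 1) :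
    ∑' k, geometricWeight γ k = 1 := by
  have := wsum_geometricWeight_exp h0 h1 (t := 0) (by simpa using h1)
  have h2 : 1 - γ ≠ 0 := by linarith
  simpa [wsum, h2] using this

/-- A geometric variable on `ℕ`. -/
noncomputable def geometricNat (γ : ℝ) (h0 : 0 ≤ γ) (h1 : γ < 1) : PMF ℕ :=
  ⟨geometricWeight γ, ENNReal.summable.hasSum_iff.2 (tsum_geometricWeight h0 h1)⟩

theorem concentratedAt_geometricWeight {γ : ℝ} (h0 : 0 ≤ γ) (h1 : γ < 1) :
    ConcentratedAt (geometricWeight γ) (γ / (1 - γ)) := by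
  have h2 : 1 - γ ≠ 0 := by linarith
  refine concentratedAt_of_hasDerivAt (φ := fun t => (1 - γ) * (1 - γ * Real.exp t)⁻¹)
    (by simp [h2]) ?_ ?_
  · have h3 := (((Real.hasDerivAt_exp 0).const_mul γ).const_sub 1).inv (by simpa using h2)
    refine (h3.const_mul (1 - γ)).congr_deriv ?_
    simp only [Real.exp_zero, mul_one]
    field_simp
  · have hc : Tendsto (fun t => γ * Real.exp t) (𝓝 0) (𝓝 (γ * Real.exp 0)) := by
      refine Continuous.tendsto ?_ 0
      fun_prop
    filter_upwards [(tendsto_order.1 hc).2 1 (by simpa using h1)] with t ht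
    rw [wsum_geometricWeight_exp h0 h1 ht, div_eq_mul_inv]

theorem wsum_cellWeight (p : ℝ) (f : Bool → ℝ≥0∞) :
    wsum (cellWeight p) f =
      ENNReal.ofReal (1 - p) * f false + ENNReal.ofReal p * f true := by
  simp [wsum, cellWeight, add_comm]

/-- The cell changes only two configurations: `(0, 0)` with a point becomes `(1, 1)`, and `(1, 1)`
always becomes `(0, 0)`. The hypothesis `h` says that these two flows balance. -/
theorem cellStationary_strict {p α β : ℝ} (hp0 : 0 ≤ p) (hp1 : p ≤ 1) (hα0 : 0 ≤ α) (hα1 : α ≤ 1)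
    (h : α * β = p * (1 - α) * (1 - β)) :
    CellStationary true (bernoulliWeight α) (bernoulliWeight β) (cellWeight p) := by
  intro f
  have h1 := ofReal_one_sub_add hp0 hp1
  have h2 : ENNReal.ofReal α * ENNReal.ofReal β =
      ENNReal.ofReal p * ENNReal.ofReal (1 - α) * ENNReal.ofReal (1 - β) := by
    rw [← ENNReal.ofReal_mul hα0, h, ENNReal.ofReal_mul (mul_nonneg hp0 (by linarith)),
      ENNReal.ofReal_mul hp0]
  simp only [wsum_bernoulliWeight, wsum_cellWeight, cellIncrement]
  simp
  generalize ENNReal.ofReal α = a at *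
  generalize ENNReal.ofReal β = b at *
  generalize ENNReal.ofReal (1 - α) = a' at *
  generalize ENNReal.ofReal (1 - β) = b' at *
  generalize ENNReal.ofReal p = q at *
  generalize ENNReal.ofReal (1 - p) = q' at *
  calc _ = a' * b' * q' * f 0 0 + (q * a' * b') * f 1 1 + a' * b * f 0 1 * (q' + q) +
        a * b' * f 1 0 * (q' + q) + (a * b) * f 0 0 * (q' + q) := by ring
    _ = a' * b' * f 0 0 * (q' + q) + (a * b) * f 1 1 + a' * b * f 0 1 +
        a * b' * f 1 0 := by rw [h1, ← h2]; nth_rw 2 [h2]; rw [mul_one, mul_one, mul_one, ← h1]; ring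
    _ = _ := by rw [h1]; ring

/-- The cell exchanges `(0, y)` with a point and `(1, y + 1)` without one, fixing all else. For a
geometric law the ratio of the vertical weights is `γ` at every height, so the single equation `h`
balances all these flows. -/
theorem cellStationary_weak {p α γ : ℝ} (hp0 : 0 ≤ p) (hp1 : p ≤ 1) (hα0 : 0 ≤ α)
    (hγ0 : 0 ≤ γ) (hγ1 : γ ≤ 1) (h : α * γ * (1 - p) = p * (1 - α)) :
    CellStationary false (bernoulliWeight α) (geometricWeight γ) (cellWeight p) := by
  intro f
  have h1 := ofReal_one_sub_add hp0 hp1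
  have h2 : ENNReal.ofReal α * ENNReal.ofReal γ * ENNReal.ofReal (1 - p) =
      ENNReal.ofReal p * ENNReal.ofReal (1 - α) := by
    rw [← ENNReal.ofReal_mul hα0, ← ENNReal.ofReal_mul (mul_nonneg hα0 hγ0), h,
      ENNReal.ofReal_mul hp0]
  have hg : ∀ k, geometricWeight γ k = ENNReal.ofReal (1 - γ) * ENNReal.ofReal γ ^ k := fun k => by
    rw [geometricWeight, ENNReal.ofReal_mul (by linarith), ENNReal.ofReal_pow hγ0]
  rw [wsum_bernoulliWeight, wsum_bernoulliWeight]
  simp only [wsum_cellWeight]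
  simp only [wsum, hg]
  have e0 : ∀ y, cellIncrement false 0 y false = y := fun y => by simp [cellIncrement]
  have e1 : ∀ y, cellIncrement false 0 y true = y + 1 := fun y => by simp [cellIncrement]
  have e2 : ∀ y, cellIncrement false 1 (y + 1) false = y + 1 := fun y => by simp [cellIncrement]
  have e3 : ∀ y, cellIncrement false 1 (y + 1) true = y + 2 := fun y => by simp [cellIncrement]
  have e4 : cellIncrement false 1 0 false = 1 := by simp [cellIncrement]
  have e5 : cellIncrement false 1 0 true = 1 := by simp [cellIncrement]
  have e6 : ∀ y, y + 2 - (y + 1) = 1 := fun y => by omega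
  have e7 : ∀ y, y + 2 - 1 = y + 1 := fun y => by omega
  -- The pair `(1, 0)` is fixed whether or not the cell has a point; it is split off so that the
  -- others are indexed by `(1, y + 1)`.
  rw [tsum_eq_zero_add' (f := fun y => ENNReal.ofReal (1 - γ) * ENNReal.ofReal γ ^ y *
      (ENNReal.ofReal (1 - p) * f (cellIncrement false 1 y false - y)
        (cellIncrement false 1 y false - 1) + ENNReal.ofReal p *
          f (cellIncrement false 1 y true - y) (cellIncrement false 1 y true - 1)))
      ENNReal.summable,
    tsum_eq_zero_add' (f := fun y => ENNReal.ofReal (1 - γ) * ENNReal.ofReal γ ^ y * f 1 y)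
      ENNReal.summable]
  simp only [e0, e1, e2, e3, e4, e5, e6, e7, Nat.sub_self, Nat.sub_zero, Nat.add_sub_cancel_left,
    Nat.add_sub_cancel]
  generalize ENNReal.ofReal α = a at *
  generalize ENNReal.ofReal γ = g at *
  generalize ENNReal.ofReal (1 - α) = a' at *
  generalize ENNReal.ofReal (1 - γ) = g' at *
  generalize ENNReal.ofReal p = q at *
  generalize ENNReal.ofReal (1 - p) = q' at *
  have s1 : ∑' y, g' * g ^ y * (q' * f 0 y + q * f 1 (y + 1)) =
      g' * (q' * ∑' y, g ^ y * f 0 y) + g' * (q * ∑' y, g ^ y * f 1 (y + 1)) := by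
    simp only [← ENNReal.tsum_mul_left]
    rw [← ENNReal.tsum_add]
    exact tsum_congr fun y => by ring
  have s2 : ∑' y, g' * g ^ (y + 1) * (q' * f 0 y + q * f 1 (y + 1)) =
      g' * g * (q' * ∑' y, g ^ y * f 0 y) + g' * g * (q * ∑' y, g ^ y * f 1 (y + 1)) := by
    simp only [← ENNReal.tsum_mul_left]
    rw [← ENNReal.tsum_add]
    exact tsum_congr fun y => by ring
  have s3 : ∑' y, g' * g ^ y * f 0 y = g' * ∑' y, g ^ y * f 0 y := by
    simp only [← ENNReal.tsum_mul_left]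
    exact tsum_congr fun y => by ring
  have s4 : ∑' y, g' * g ^ (y + 1) * f 1 (y + 1) = g' * g * ∑' y, g ^ y * f 1 (y + 1) := by
    simp only [← ENNReal.tsum_mul_left]
    exact tsum_congr fun y => by ring
  rw [s1, s2, s3, s4]
  generalize ∑' y, g ^ y * f 0 y = A
  generalize ∑' y, g ^ y * f 1 (y + 1) = B
  have t1 : a' * q' + a * g * q' = a' * (q' + q) := by rw [h2]; ring
  have t2 : q * a' + a * g * q = a * g * (q' + q) := by rw [← h2]; ring
  calc _ = g' * A * (a' * q' + a * g * q') + g' * B * (q * a' + a * g * q) +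
        a * g' * f 1 0 * (q' + q) := by ring
    _ = g' * A * (a' * (q' + q)) + g' * B * (a * g * (q' + q)) + a * g' * f 1 0 * (q' + q) := by
        rw [t1, t2]
    _ = _ := by rw [h1]; ring

/-! ### Elementary bounds on last passage values without boundary -/

theorem lastPassage_le_left (strict : Bool) (e : ℕ → ℕ → Bool) (i j : ℕ) :
    lastPassage strict e 0 0 i j ≤ i := by
  induction i generalizing j with
  | zero => simp [lastPassage_zero_left]
  | succ i ih =>
    induction j with
    | zero => simp [lastPassage_zero_right]
    | succ j ihj =>
      rw [lastPassage_succ_succ]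
      have h1 := ih j
      have h2 := ih (j + 1)
      have h3 := Bool.toNat_le (e i j)
      cases strict <;> simp <;> omega

theorem lastPassage_strict_le_right (e : ℕ → ℕ → Bool) (i j : ℕ) :
    lastPassage true e 0 0 i j ≤ j := by
  induction i generalizing j with
  | zero => simp [lastPassage_zero_left]
  | succ i ih =>
    induction j with
    | zero => simp [lastPassage_zero_right]
    | succ j ihj =>
      rw [lastPassage_succ_succ]
      have h1 := ih j
      have h2 := ih (j + 1)
      have h3 := Bool.toNat_le (e i j)
      simp
      omega

theorem le_lastPassage_strict_of_full {e : ℕ → ℕ → Bool} (he : ∀ i j, e i j = true) (k : ℕ) :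
    k ≤ lastPassage true e 0 0 k k := by
  induction k with
  | zero => exact Nat.zero_le _
  | succ k ih =>
    rw [lastPassage_succ_succ, he]
    simp
    omega

theorem le_lastPassage_weak_of_full {e : ℕ → ℕ → Bool} (he : ∀ i j, e i j = true) (k : ℕ) :
    k ≤ lastPassage false e 0 0 k 1 := by
  induction k with
  | zero => exact Nat.zero_le _
  | succ k ih =>
    rw [show (1 : ℕ) = 0 + 1 from rfl, lastPassage_succ_succ, he]
    simp
    omega

/-! ### Almost sure linear bounds -/

section Bounds

variable {Ω : Type*} [MeasurableSpace Ω]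

/-- Almost surely the last passage values in direction `(a, b)` are asymptotically at least
linear of rate `c`. -/
def RateAtLeast (μ : Measure Ω) (strict : Bool) (e : Ω → ℕ → ℕ → Bool) (a b c : ℝ) : Prop :=
  ∀ ε > 0, ∀ᵐ ω ∂μ, ∀ᶠ n : ℕ in atTop, (c - ε) * n ≤
    (lastPassage strict (e ω) 0 0 ⌊a * (n : ℝ)⌋₊ ⌊b * (n : ℝ)⌋₊ : ℝ)

/-- Almost surely the last passage values in direction `(a, b)` are asymptotically at most
linear of rate `c`. -/
def RateAtMost (μ : Measure Ω) (strict : Bool) (e : Ω → ℕ → ℕ → Bool) (a b c : ℝ) : Prop :=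
  ∀ ε > 0, ∀ᵐ ω ∂μ, ∀ᶠ n : ℕ in atTop,
    (lastPassage strict (e ω) 0 0 ⌊a * (n : ℝ)⌋₊ ⌊b * (n : ℝ)⌋₊ : ℝ) ≤ (c + ε) * n

variable {μ : Measure Ω} {strict : Bool} {e : Ω → ℕ → ℕ → Bool} {a b c : ℝ}

/-- In both rate bounds `ε` precedes the almost sure quantifier, so auxiliary densities may depend
on it; countably many `ε` suffice here. -/
theorem RateAtLeast.ae_tendsto (h1 : RateAtLeast μ strict e a b c)
    (h2 : RateAtMost μ strict e a b c) :
    ∀ᵐ ω ∂μ, Tendsto (fun n : ℕ =>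
      (lastPassage strict (e ω) 0 0 ⌊a * (n : ℝ)⌋₊ ⌊b * (n : ℝ)⌋₊ : ℝ) / n) atTop (𝓝 c) := by
  have h1' := ae_all_iff.2 fun r : ℕ => h1 (1 / ((r : ℝ) + 1)) (by positivity)
  have h2' := ae_all_iff.2 fun r : ℕ => h2 (1 / ((r : ℝ) + 1)) (by positivity)
  filter_upwards [h1', h2'] with ω h3 h4
  refine Metric.tendsto_nhds.2 fun ε hε => ?_
  obtain ⟨r, hr⟩ := exists_nat_one_div_lt hε
  filter_upwards [h3 r, h4 r, eventually_gt_atTop 0] with n h5 h6 h7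
  have hn : (0 : ℝ) < n := by exact_mod_cast h7
  rw [← le_div_iff₀ hn] at h5
  rw [← div_le_iff₀ hn] at h6
  rw [Real.dist_eq, abs_lt]
  constructor <;> linarith

/-- A smaller rectangle has a smaller value, so lower bounds pass to larger directions. -/
theorem RateAtLeast.of_approx
    (h : ∀ δ > 0, ∃ a' b' c', a' ≤ a ∧ b' ≤ b ∧ c - δ < c' ∧ RateAtLeast μ strict e a' b' c') :
    RateAtLeast μ strict e a b c := by
  intro ε hε
  obtain ⟨a', b', c', ha, hb, hc, hr⟩ := h (ε / 2) (half_pos hε)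
  filter_upwards [hr (ε / 2) (half_pos hε)] with ω hω
  filter_upwards [hω] with n hn
  calc (c - ε) * n ≤ (c' - ε / 2) * n := by
        refine mul_le_mul_of_nonneg_right ?_ n.cast_nonneg
        linarith
    _ ≤ _ := hn
    _ ≤ _ := by
        exact_mod_cast lastPassage_mono strict (e ω) 0 0
          (Nat.floor_mono (mul_le_mul_of_nonneg_right ha n.cast_nonneg))
          (Nat.floor_mono (mul_le_mul_of_nonneg_right hb n.cast_nonneg))

theorem rateAtLeast_zero : RateAtLeast μ strict e a b 0 := by
  intro ε hε
  refine ae_of_all _ fun ω => Eventually.of_forall fun n => ?_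
  have : (0 - ε) * n ≤ 0 := mul_nonpos_of_nonpos_of_nonneg (by linarith) n.cast_nonneg
  exact this.trans (Nat.cast_nonneg _)

theorem rateAtMost_left (ha : 0 ≤ a) : RateAtMost μ strict e a b a := by
  intro ε hε
  refine ae_of_all _ fun ω => Eventually.of_forall fun n => ?_
  calc _ ≤ (⌊a * (n : ℝ)⌋₊ : ℝ) := by exact_mod_cast lastPassage_le_left strict (e ω) _ _
    _ ≤ a * n := Nat.floor_le (by positivity)
    _ ≤ _ := mul_le_mul_of_nonneg_right (by linarith) n.cast_nonneg

theorem rateAtMost_strict_min (ha : 0 ≤ a) (hb : 0 ≤ b) : RateAtMost μ true e a b (min a b) := by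
  rcases min_choice a b with h | h <;> rw [h]
  · exact rateAtMost_left ha
  intro ε hε
  refine ae_of_all _ fun ω => Eventually.of_forall fun n => ?_
  calc _ ≤ (⌊b * (n : ℝ)⌋₊ : ℝ) := by exact_mod_cast lastPassage_strict_le_right (e ω) _ _
    _ ≤ b * n := Nat.floor_le (by positivity)
    _ ≤ _ := mul_le_mul_of_nonneg_right (by linarith) n.cast_nonneg

theorem rateAtMost_of_hasStationaryBoundary {α β : ℝ}
    (h : ∀ᵐ ω ∂μ, HasStationaryBoundary strict (e ω) a b α β) :
    RateAtMost μ strict e a b (a * α + b * β) := by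
  intro ε hε
  filter_upwards [h] with ω hω
  exact hω.eventually_le hε

/-- If the stationary densities run through the curve `(A + s u, B + t / u)`, then the rate is
attained at the minimizer of the stationary rate along the curve. -/
theorem rateAtLeast_of_curve {A B s t lo hi u₀ : ℝ} (ha : 0 < a) (hb : 0 < b) (hs : 0 < s)
    (ht : 0 < t) (hu : 0 < u₀) (hlo : lo < u₀) (hhi : u₀ < hi) (hopt : a * s * u₀ ^ 2 = b * t)
    (hA : 0 ≤ A + s * u₀) (hB : 0 ≤ B + t / u₀)
    (h : ∀ u, 0 < u → lo < u → u < hi →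
      ∀ᵐ ω ∂μ, HasStationaryBoundary strict (e ω) a b (A + s * u) (B + t / u)) :
    RateAtLeast μ strict e a b (a * (A + s * u₀) + b * (B + t / u₀)) := by
  intro ε hε
  set κ := (A + s * u₀) + (B + t / u₀) + 1 with hκ
  have hκ0 : 0 < κ := by linarith
  set η := ε / κ with hη
  have hη0 : 0 < η := by positivity
  -- By `hopt` the first-order term vanishes at `u₀`: the excess rate is exactly quadratic.
  have hdiff : ∀ u, 0 < u → a * (A + s * u) + b * (B + t / u) -
      (a * (A + s * u₀) + b * (B + t / u₀)) = a * s * (u - u₀) ^ 2 / u := by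
    intro u hu'
    have : b * (B + t / u) - b * (B + t / u₀) = b * t * (1 / u - 1 / u₀) := by ring
    have h2 : a * s * (u - u₀) + a * s * u₀ ^ 2 * (1 / u - 1 / u₀) = a * s * (u - u₀) ^ 2 / u := by
      field_simp
      ring
    rw [← h2, hopt, ← this]
    ring
  -- Moving `u` up raises the horizontal density and moving it down raises the vertical one. The
  -- distances are chosen so that the quadratic excess stays below `η` times the density gain.
  obtain ⟨u₁, h10, h11⟩ := exists_between
    (lt_min hhi (lt_add_of_pos_right u₀ (by positivity : 0 < η * u₀ / a)))
  obtain ⟨u₂, h20, h21⟩ := exists_between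
    (max_lt (max_lt hlo hu) (sub_lt_self u₀ (by positivity : 0 < η * t / (a * s * u₀))))
  obtain ⟨h12, h13⟩ := lt_min_iff.1 h11
  obtain ⟨h22, h23⟩ := max_lt_iff.1 h20
  obtain ⟨h24, h25⟩ := max_lt_iff.1 h22
  have hu₁ : 0 < u₁ := hu.trans h10
  filter_upwards [h u₀ hu hlo hhi, h u₁ hu₁ (hlo.trans h10) h12, h u₂ h25 h24 (h21.trans hhi)]
    with ω hω0 hω1 hω2
  have hx : ∃ α' β', HasStationaryBoundary strict (e ω) a b α' β' ∧ A + s * u₀ < α' ∧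
      a * α' + b * β' - (a * (A + s * u₀) + b * (B + t / u₀)) < η * (α' - (A + s * u₀)) := by
    refine ⟨_, _, hω1, by nlinarith, ?_⟩
    rw [hdiff u₁ hu₁, div_lt_iff₀ hu₁]
    have h14 : a * (u₁ - u₀) < η * u₀ := by
      rw [← sub_lt_iff_lt_add', lt_div_iff₀ ha] at h13
      linarith
    have h15 : a * (u₁ - u₀) < η * u₁ := h14.trans (mul_lt_mul_of_pos_left h10 hη0)
    have h16 := mul_lt_mul_of_pos_left h15 (mul_pos hs (sub_pos.2 h10))
    nlinarith
  have hy : ∃ α' β', HasStationaryBoundary strict (e ω) a b α' β' ∧ B + t / u₀ < β' ∧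
      a * α' + b * β' - (a * (A + s * u₀) + b * (B + t / u₀)) < η * (β' - (B + t / u₀)) := by
    refine ⟨_, _, hω2, ?_, ?_⟩
    · have := div_lt_div_of_pos_left ht h25 h21
      linarith
    · have h26 : B + t / u₂ - (B + t / u₀) = t * (u₀ - u₂) / u₀ / u₂ := by
        field_simp
        ring
      rw [hdiff u₂ h25, h26, ← mul_div_assoc, div_lt_div_iff_of_pos_right h25, ← mul_div_assoc,
        lt_div_iff₀ hu]
      have h27 : (u₀ - u₂) * (a * s * u₀) < η * t := by
        rw [← lt_div_iff₀ (by positivity)]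
        linarith
      have h28 := mul_lt_mul_of_pos_left h27 (sub_pos.2 h21)
      nlinarith
  have := hω0.eventually_ge ha hb hA hB hη0 hx hy
  filter_upwards [this] with n hn
  rwa [← hκ, hη, div_mul_cancel₀ _ hκ0.ne'] at hn

end Bounds

/-! ### The two limits -/

section Limits

variable {Ω : Type*} [MeasurableSpace Ω] {μ : Measure Ω} [IsProbabilityMeasure μ]
  {p : ℝ} {ξ : Ω → Set (ℕ+ × ℕ+)} {a b : ℝ}

theorem ae_hasStationaryBoundary_strict (hp0 : 0 ≤ p) (hp1 : p ≤ 1)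
    (hξ : IsBernoulliPointSet μ p ξ) (ha : 0 < a) (hb : 0 < b) {α β : ℝ} (hα0 : 0 ≤ α)
    (hα1 : α ≤ 1) (hβ0 : 0 ≤ β) (hβ1 : β ≤ 1) (h : α * β = p * (1 - α) * (1 - β)) :
    ∀ᵐ ω ∂μ, HasStationaryBoundary true (cells (ξ ω)) a b α β :=
  hξ.ae_hasStationaryBoundary hp0 (wx := bernoulliNat α hα0 hα1) (wy := bernoulliNat β hβ0 hβ1)
    (cellStationary_strict hp0 hp1 hα0 hα1 h) (concentratedAt_bernoulliWeight hα0 hα1)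
    (concentratedAt_bernoulliWeight hβ0 hβ1) ha hb

theorem ae_hasStationaryBoundary_weak (hp0 : 0 ≤ p) (hp1 : p ≤ 1)
    (hξ : IsBernoulliPointSet μ p ξ) (ha : 0 < a) (hb : 0 < b) {α γ : ℝ} (hα0 : 0 ≤ α)
    (hα1 : α ≤ 1) (hγ0 : 0 ≤ γ) (hγ1 : γ < 1) (h : α * γ * (1 - p) = p * (1 - α)) :
    ∀ᵐ ω ∂μ, HasStationaryBoundary false (cells (ξ ω)) a b α (γ / (1 - γ)) :=
  hξ.ae_hasStationaryBoundary hp0 (wx := bernoulliNat α hα0 hα1) (wy := geometricNat γ hγ0 hγ1)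
    (cellStationary_weak hp0 hp1 hα0 hγ0 hγ1.le h) (concentratedAt_bernoulliWeight hα0 hα1)
    (concentratedAt_geometricWeight hγ0 hγ1) ha hb

/-- The limit of the strict last passage values in the non-degenerate regime. -/
noncomputable def strictRate (p a b : ℝ) : ℝ :=
  √p * (2 * √(a * b) - (a + b) * √p) / (1 - p)

/-- The limit of the weak last passage values in the non-degenerate regime. -/
noncomputable def weakRate (p a b : ℝ) : ℝ :=
  2 * √(a * b * p * (1 - p)) + (a - b) * p

/-- With `c = p / (1 - p)` the balance equation is the hyperbola `(α + c)(β + c) = p / (1 - p)²`,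
and `p < u < 1` keeps both densities in `(0, 1)`. The minimizer `u₀ = √(b p / a)` lies in that
interval exactly when `p < min (a / b) (b / a)`. -/
theorem strict_rate_of_pos (hp : 0 < p) (hξ : IsBernoulliPointSet μ p ξ) (ha : 0 < a) (hb : 0 < b)
    (h : p < min (a / b) (b / a)) :
    RateAtLeast μ true (fun ω => cells (ξ ω)) a b (strictRate p a b) ∧
      RateAtMost μ true (fun ω => cells (ξ ω)) a b (strictRate p a b) := by
  obtain ⟨h1, h2⟩ := lt_min_iff.1 h
  rw [lt_div_iff₀ hb] at h1
  rw [lt_div_iff₀ ha] at h2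
  have hp1 : p < 1 := by
    by_contra hcon
    have := not_lt.1 hcon
    nlinarith
  have hq : 0 < 1 - p := by linarith
  set u₀ := √(b * p / a) with hu₀
  have hu : 0 < u₀ := Real.sqrt_pos.2 (by positivity)
  have hsq : u₀ ^ 2 = b * p / a := Real.sq_sqrt (by positivity)
  have hsq' : a * u₀ ^ 2 = b * p := by rw [hsq]; field_simp
  have hlo : p < u₀ := by
    refine lt_of_pow_lt_pow_left₀ 2 hu.le ?_
    rw [hsq, lt_div_iff₀ ha]
    nlinarith
  have hhi : u₀ < 1 := by
    refine lt_of_pow_lt_pow_left₀ 2 one_pos.le ?_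
    rw [hsq, div_lt_iff₀ ha]
    linarith
  have hαeq : ∀ u, -p / (1 - p) + 1 / (1 - p) * u = (u - p) / (1 - p) := fun u => by ring
  have hβeq : ∀ u, 0 < u → -p / (1 - p) + p / (1 - p) / u = p * (1 - u) / ((1 - p) * u) := by
    intro u hu'
    field_simp
    ring
  have hcurve : ∀ u, 0 < u → p < u → u < 1 → ∀ᵐ ω ∂μ, HasStationaryBoundary true (cells (ξ ω)) a b
      (-p / (1 - p) + 1 / (1 - p) * u) (-p / (1 - p) + p / (1 - p) / u) := by
    intro u hu0 hpu hu1
    rw [hαeq, hβeq u hu0]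
    refine ae_hasStationaryBoundary_strict hp.le hp1.le hξ ha hb ?_ ?_ ?_ ?_ ?_
    · exact div_nonneg (by linarith) hq.le
    · rw [div_le_one hq]; linarith
    · exact div_nonneg (mul_nonneg hp.le (by linarith)) (by positivity)
    · rw [div_le_one (by positivity)]; nlinarith
    · field_simp
      ring
  have hval : a * (-p / (1 - p) + 1 / (1 - p) * u₀) + b * (-p / (1 - p) + p / (1 - p) / u₀) =
      strictRate p a b := by
    have e1 : √p * √(a * b) = a * u₀ := by
      rw [← Real.sqrt_mul hp.le]
      rw [← Real.sqrt_sq (by positivity : 0 ≤ a * u₀), mul_pow, hsq]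
      congr 1
      field_simp
    have e2 : √p * √p = p := Real.mul_self_sqrt hp.le
    have e3 : b * p / u₀ = a * u₀ := by
      rw [← hsq']
      field_simp
    have e4 : strictRate p a b = (2 * (a * u₀) - (a + b) * p) / (1 - p) := by
      rw [strictRate, ← e1, ← e2]
      congr 1
      rw [e2]
      nlinarith
    rw [e4]
    have e5 : a * (-p / (1 - p) + 1 / (1 - p) * u₀) + b * (-p / (1 - p) + p / (1 - p) / u₀) =
        (a * u₀ + b * p / u₀ - (a + b) * p) / (1 - p) := by ring
    rw [e5, e3]
    ring
  rw [← hval]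
  refine ⟨rateAtLeast_of_curve ha hb (by positivity) (by positivity) hu hlo hhi ?_ ?_ ?_ hcurve,
    rateAtMost_of_hasStationaryBoundary (hcurve u₀ hu hlo hhi)⟩
  · rw [mul_assoc, mul_comm (1 / (1 - p)), ← mul_assoc, hsq']
    ring
  · rw [hαeq]
    exact div_nonneg (by linarith) hq.le
  · rw [hβeq _ hu]
    exact div_nonneg (mul_nonneg hp.le (by linarith)) (by positivity)

/-- In terms of the mean `β = γ / (1 - γ)` the balance equation reads `(α - p)(β + p) = p (1 - p)`,
parametrized by `u = α - p`. The constraint `u₀ < 1 - p` is equivalent to `p < a / (a + b)`. -/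
theorem weak_rate_of_pos (hp : 0 < p) (hξ : IsBernoulliPointSet μ p ξ) (ha : 0 < a) (hb : 0 < b)
    (h : p < a / (a + b)) :
    RateAtLeast μ false (fun ω => cells (ξ ω)) a b (weakRate p a b) ∧
      RateAtMost μ false (fun ω => cells (ξ ω)) a b (weakRate p a b) := by
  rw [lt_div_iff₀ (by positivity)] at h
  have hp1 : p < 1 := by
    by_contra hcon
    have := not_lt.1 hcon
    nlinarith
  have hq : 0 < 1 - p := by linarith
  set u₀ := √(b * (p * (1 - p)) / a) with hu₀
  have hu : 0 < u₀ := Real.sqrt_pos.2 (by positivity)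
  have hsq : u₀ ^ 2 = b * (p * (1 - p)) / a := Real.sq_sqrt (by positivity)
  have hsq' : a * u₀ ^ 2 = b * (p * (1 - p)) := by rw [hsq]; field_simp
  have hhi : u₀ < 1 - p := by
    refine lt_of_pow_lt_pow_left₀ 2 hq.le ?_
    rw [hsq, div_lt_iff₀ ha]
    nlinarith
  have hcurve : ∀ u, 0 < u → 0 < u → u < 1 - p → ∀ᵐ ω ∂μ,
      HasStationaryBoundary false (cells (ξ ω)) a b (p + 1 * u) (-p + p * (1 - p) / u) := by
    intro u hu0 _ hu1
    have hd : 0 < (p + u) * (1 - p) := by positivity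
    have hγ : 1 - p * (1 - p - u) / ((p + u) * (1 - p)) = u / ((p + u) * (1 - p)) := by
      field_simp
      ring
    have hβ : -p + p * (1 - p) / u = p * (1 - p - u) / ((p + u) * (1 - p)) /
        (1 - p * (1 - p - u) / ((p + u) * (1 - p))) := by
      rw [hγ]
      field_simp
      ring
    rw [one_mul, hβ]
    refine ae_hasStationaryBoundary_weak hp.le hp1.le hξ ha hb (by linarith) (by linarith) ?_ ?_ ?_
    · exact div_nonneg (mul_nonneg hp.le (by linarith)) hd.le
    · rw [← sub_pos, hγ]
      positivity
    · have : p + u ≠ 0 := by positivity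
      field_simp
      ring
  have hval : a * (p + 1 * u₀) + b * (-p + p * (1 - p) / u₀) = weakRate p a b := by
    have e1 : √(a * b * p * (1 - p)) = a * u₀ := by
      rw [← Real.sqrt_sq (by positivity : 0 ≤ a * u₀), mul_pow, hsq]
      congr 1
      field_simp
    have e3 : b * (p * (1 - p)) / u₀ = a * u₀ := by
      rw [← hsq']
      field_simp
    rw [weakRate, e1]
    have e5 : a * (p + 1 * u₀) + b * (-p + p * (1 - p) / u₀) =
        a * u₀ + b * (p * (1 - p)) / u₀ + (a - b) * p := by ring
    rw [e5, e3]
    ring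
  rw [← hval]
  refine ⟨rateAtLeast_of_curve ha hb one_pos (by positivity) hu hu hhi ?_ ?_ ?_ hcurve,
    rateAtMost_of_hasStationaryBoundary (hcurve u₀ hu hu hhi)⟩
  · rw [mul_one, hsq']
  · positivity
  · have : p ≤ p * (1 - p) / u₀ := by
      rw [le_div_iff₀ hu]
      exact mul_le_mul_of_nonneg_left hhi.le hp.le
    linarith

/-! ### Extreme densities and degenerate regimes. -/

theorem strict_rateAtMost_zero (hξ : IsBernoulliPointSet μ 0 ξ) (ha : 0 < a) (hb : 0 < b) :
    RateAtMost μ true (fun ω => cells (ξ ω)) a b 0 := by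
  simpa using rateAtMost_of_hasStationaryBoundary
    (ae_hasStationaryBoundary_strict (α := 0) (β := 0) le_rfl zero_le_one hξ ha hb le_rfl
      zero_le_one le_rfl zero_le_one (by simp))

theorem weak_rateAtMost_zero (hξ : IsBernoulliPointSet μ 0 ξ) (ha : 0 < a) (hb : 0 < b) :
    RateAtMost μ false (fun ω => cells (ξ ω)) a b 0 := by
  simpa using rateAtMost_of_hasStationaryBoundary
    (ae_hasStationaryBoundary_weak (α := 0) (γ := 0) le_rfl zero_le_one hξ ha hb le_rfl
      zero_le_one le_rfl zero_lt_one (by simp))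

theorem ae_cells_full (hξ : IsBernoulliPointSet μ 1 ξ) :
    ∀ᵐ ω ∂μ, ∀ i j, cells (ξ ω) i j = true := by
  refine ae_all_iff.2 fun i => ae_all_iff.2 fun j => ?_
  have := hξ.measure_cells zero_le_one i j false
  rw [ae_iff]
  simpa [cellWeight] using this

theorem strict_rateAtLeast_full (hξ : IsBernoulliPointSet μ 1 ξ) :
    RateAtLeast μ true (fun ω => cells (ξ ω)) a b (min a b) := by
  intro ε hε
  filter_upwards [ae_cells_full hξ] with ω hω
  filter_upwards [(tendsto_natCast_atTop_atTop.const_mul_atTop hε).eventually_ge_atTop (1 : ℝ)]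
    with n hn
  have h1 := (le_lastPassage_strict_of_full hω ⌊min a b * (n : ℝ)⌋₊).trans
    (lastPassage_mono true (cells (ξ ω)) 0 0
      (Nat.floor_mono (mul_le_mul_of_nonneg_right (min_le_left a b) n.cast_nonneg))
      (Nat.floor_mono (mul_le_mul_of_nonneg_right (min_le_right a b) n.cast_nonneg)))
  have h2 := Nat.lt_floor_add_one (min a b * (n : ℝ))
  rify at h1
  linarith

theorem weak_rateAtLeast_full (hξ : IsBernoulliPointSet μ 1 ξ) (hb : 0 < b) :
    RateAtLeast μ false (fun ω => cells (ξ ω)) a b a := by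
  intro ε hε
  filter_upwards [ae_cells_full hξ] with ω hω
  filter_upwards [(tendsto_natCast_atTop_atTop.const_mul_atTop hε).eventually_ge_atTop (1 : ℝ),
    (tendsto_natCast_atTop_atTop.const_mul_atTop hb).eventually_ge_atTop (1 : ℝ)] with n hn hn'
  have h1 := (le_lastPassage_weak_of_full hω ⌊a * (n : ℝ)⌋₊).trans
    (lastPassage_mono_right false (cells (ξ ω)) 0 0 _ (Nat.le_floor (by exact_mod_cast hn')))
  have h2 := Nat.lt_floor_add_one (a * (n : ℝ))
  rify at h1
  linarith

theorem strictRate_comm (p a b : ℝ) : strictRate p a b = strictRate p b a := by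
  rw [strictRate, strictRate, mul_comm a b, add_comm a b]

/-- In this direction the minimizer reaches `u₀ = 1`, that is horizontal density `1`, and the rate
meets the trivial bound. -/
theorem strictRate_critical (hp : 0 < p) (hp1 : p < 1) (ha : 0 < a) : strictRate p a (a / p) = a := by
  have h1 : √p * √p = p := Real.mul_self_sqrt hp.le
  have h2 : √p * √(a * (a / p)) = a := by
    rw [← Real.sqrt_mul hp.le, show p * (a * (a / p)) = a ^ 2 by field_simp, Real.sqrt_sq ha.le]
  have h3 : (1 - p) ≠ 0 := by linarith
  have h4 : √p * (2 * √(a * (a / p)) - (a + a / p) * √p) =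
      2 * (√p * √(a * (a / p))) - (a + a / p) * (√p * √p) := by ring
  rw [strictRate, h4, h1, h2]
  field_simp
  ring

theorem weakRate_critical (hp : 0 < p) (hp1 : p < 1) (ha : 0 < a) :
    weakRate p a (a * (1 - p) / p) = a := by
  have h3 : 0 < 1 - p := by linarith
  have h2 : √(a * (a * (1 - p) / p) * p * (1 - p)) = a * (1 - p) := by
    rw [show a * (a * (1 - p) / p) * p * (1 - p) = (a * (1 - p)) ^ 2 by field_simp,
      Real.sqrt_sq (by positivity)]
  rw [weakRate, h2]
  field_simp
  ring

/-- Below the critical slope there are directions with rate arbitrarily close to `a`. -/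
theorem exists_strictRate_gt (hp : 0 < p) (hp1 : p < 1) (ha : 0 < a) {δ : ℝ} (hδ : 0 < δ) :
    ∃ b', 0 < b' ∧ b' ≤ a / p ∧ p < min (a / b') (b' / a) ∧ a - δ < strictRate p a b' := by
  have hcont : Continuous fun b' => strictRate p a b' := by
    unfold strictRate
    fun_prop
  have h1 : Tendsto (fun b' => strictRate p a b') (𝓝[<] (a / p)) (𝓝 a) := by
    have := (hcont.tendsto (a / p)).mono_left (nhdsWithin_le_nhds (s := Set.Iio (a / p)))
    rwa [strictRate_critical hp hp1 ha] at this
  -- There is room to take `b'` above `a`, which makes `p < b' / a` automatic.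
  have h2 : a < a / p := by
    rw [lt_div_iff₀ hp]
    nlinarith
  obtain ⟨b', ⟨h3, h4⟩, h5⟩ := (((tendsto_order.1 h1).1 (a - δ) (by linarith)).and
    (Ioo_mem_nhdsLT h2)).and self_mem_nhdsWithin |>.exists
  have hb' : 0 < b' := ha.trans h4.1
  refine ⟨b', hb', h4.2.le, lt_min ?_ ?_, h3⟩
  · have := h4.2
    rw [lt_div_iff₀ hp] at this
    rw [lt_div_iff₀ hb']
    linarith
  · exact hp1.trans ((one_lt_div ha).2 h4.1)

theorem exists_weakRate_gt (hp : 0 < p) (hp1 : p < 1) (ha : 0 < a) {δ : ℝ} (hδ : 0 < δ) :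
    ∃ b', 0 < b' ∧ b' ≤ a * (1 - p) / p ∧ p < a / (a + b') ∧ a - δ < weakRate p a b' := by
  have hcont : Continuous fun b' => weakRate p a b' := by
    unfold weakRate
    fun_prop
  have h1 : Tendsto (fun b' => weakRate p a b') (𝓝[<] (a * (1 - p) / p)) (𝓝 a) := by
    have := (hcont.tendsto (a * (1 - p) / p)).mono_left
      (nhdsWithin_le_nhds (s := Set.Iio (a * (1 - p) / p)))
    rwa [weakRate_critical hp hp1 ha] at this
  have h2 : 0 < a * (1 - p) / p := div_pos (mul_pos ha (by linarith)) hp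
  obtain ⟨b', h3, h4⟩ := (((tendsto_order.1 h1).1 (a - δ) (by linarith)).and
    (Ioo_mem_nhdsLT h2)).exists
  refine ⟨b', h4.1, h4.2.le, ?_, h3⟩
  have := h4.2
  rw [lt_div_iff₀ hp] at this
  rw [lt_div_iff₀ (add_pos ha h4.1)]
  linarith

/-- If `a / b ≤ p`, the critical direction `(a, a / p)` fits inside `(a, b)`, and directions just
below it already have rates close to `a`. The other case is its mirror image. -/
theorem strict_rateAtLeast_degenerate (hp0 : 0 ≤ p) (hp1 : p ≤ 1) (hξ : IsBernoulliPointSet μ p ξ)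
    (ha : 0 < a) (hb : 0 < b) (h : ¬ p < min (a / b) (b / a)) :
    RateAtLeast μ true (fun ω => cells (ξ ω)) a b (min a b) := by
  rcases hp1.eq_or_lt with rfl | hp1
  · exact strict_rateAtLeast_full hξ
  have hp : 0 < p := lt_of_lt_of_le (by positivity) (not_lt.1 h)
  rcases min_le_iff.1 (not_lt.1 h) with h1 | h1
  · have h2 : a / p ≤ b := by
      rw [div_le_iff₀ hb] at h1
      rw [div_le_iff₀ hp]
      linarith
    have hab : a ≤ b := by
      rw [div_le_iff₀ hb] at h1
      nlinarith
    rw [min_eq_left hab]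
    refine RateAtLeast.of_approx fun δ hδ => ?_
    obtain ⟨b', h3, h4, h5, h6⟩ := exists_strictRate_gt hp hp1 ha hδ
    exact ⟨a, b', _, le_rfl, h4.trans h2, h6, (strict_rate_of_pos hp hξ ha h3 h5).1⟩
  · have h2 : b / p ≤ a := by
      rw [div_le_iff₀ ha] at h1
      rw [div_le_iff₀ hp]
      linarith
    have hab : b ≤ a := by
      rw [div_le_iff₀ ha] at h1
      nlinarith
    rw [min_eq_right hab]
    refine RateAtLeast.of_approx fun δ hδ => ?_
    obtain ⟨a', h3, h4, h5, h6⟩ := exists_strictRate_gt hp hp1 hb hδ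
    rw [min_comm] at h5
    rw [strictRate_comm] at h6
    exact ⟨a', b, _, h4.trans h2, le_rfl, h6, (strict_rate_of_pos hp hξ h3 hb h5).1⟩

theorem weak_rateAtLeast_degenerate (hp1 : p ≤ 1) (hξ : IsBernoulliPointSet μ p ξ)
    (ha : 0 < a) (hb : 0 < b) (h : ¬ p < a / (a + b)) :
    RateAtLeast μ false (fun ω => cells (ξ ω)) a b a := by
  rcases hp1.eq_or_lt with rfl | hp1
  · exact weak_rateAtLeast_full hξ hb
  have hp : 0 < p := lt_of_lt_of_le (by positivity) (not_lt.1 h)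
  have h2 : a * (1 - p) / p ≤ b := by
    have h1 := not_lt.1 h
    rw [div_le_iff₀ (by positivity)] at h1
    rw [div_le_iff₀ hp]
    linarith
  refine RateAtLeast.of_approx fun δ hδ => ?_
  obtain ⟨b', h3, h4, h5, h6⟩ := exists_weakRate_gt hp hp1 ha hδ
  exact ⟨a, b', _, le_rfl, h4.trans h2, h6, (weak_rate_of_pos hp hξ ha h3 h5).1⟩

end Limits

theorem theorem1 {Ω : Type*} [MeasurableSpace Ω] (μ : Measure Ω) [IsProbabilityMeasure μ]
    (p : ℝ) (hp0 : 0 ≤ p) (hp1 : p ≤ 1)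
    (ξ : Ω → Set (ℕ+ × ℕ+)) (hξ : IsBernoulliPointSet μ p ξ)
    (a b : ℝ) (ha : 0 < a) (hb : 0 < b) :
    (∀ᵐ ω ∂μ, Tendsto
      (fun n : ℕ => (longestStrict (ξ ω) ⌊a * (n : ℝ)⌋₊ ⌊b * (n : ℝ)⌋₊ : ℝ) / (n : ℝ)) atTop
      (𝓝 (if p < min (a / b) (b / a) then
          √p * (2 * √(a * b) - (a + b) * √p) / (1 - p)
        else min a b))) ∧
    (∀ᵐ ω ∂μ, Tendsto
      (fun n : ℕ => (longestWeak (ξ ω) ⌊a * (n : ℝ)⌋₊ ⌊b * (n : ℝ)⌋₊ : ℝ) / (n : ℝ)) atTop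
      (𝓝 (if p < a / (a + b) then
          2 * √(a * b * p * (1 - p)) + (a - b) * p
        else a))) := by
  simp only [longestStrict_eq, longestWeak_eq]
  constructor
  · split_ifs with h
    · rcases hp0.eq_or_lt with rfl | hp
      · simpa using RateAtLeast.ae_tendsto rateAtLeast_zero (strict_rateAtMost_zero hξ ha hb)
      · obtain ⟨h1, h2⟩ := strict_rate_of_pos hp hξ ha hb h
        exact h1.ae_tendsto h2
    · exact (strict_rateAtLeast_degenerate hp0 hp1 hξ ha hb h).ae_tendsto
        (rateAtMost_strict_min ha.le hb.le)
  · split_ifs with h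
    · rcases hp0.eq_or_lt with rfl | hp
      · simpa using RateAtLeast.ae_tendsto rateAtLeast_zero (weak_rateAtMost_zero hξ ha hb)
      · obtain ⟨h1, h2⟩ := weak_rate_of_pos hp hξ ha hb h
        exact h1.ae_tendsto h2
    · exact (weak_rateAtLeast_degenerate hp1 hξ ha hb h).ae_tendsto (rateAtMost_left ha.le)
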